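/- Let $N\ge 3$, $\varepsilon>0$ and $\alpha,\beta,\gamma,\omega\in\mathbb R$. Let $f$ be a nonlinearity, i.e. a map sending a density $r:\mathbb R^N\to\mathbb R$ to a real function $f(r)$ on $\mathbb R^N$ (for a local nonlinearity, $f(r)(x)=g(r(x))$), which commutes with the changes of variable $x\mapsto \varepsilon^{-\beta}(x-b)$, $b\in\mathbb R^N$ (every local nonlinearity does). Assume that either $\alpha=\gamma$ and $\beta=1$, or $f$ is homogeneous of some degree $p\in(0,\frac{2}{N-2})$ and $\beta=1+(\alpha-\gamma)p$. Let $U\in H^1(\mathbb R^N)\cap L^\infty(\mathbb R^N)$ be a positive weak solution of $-\Delta U+f(U^2)U-\omega U=0$ with $$\||x|U^2\|_{L^1}+\||x|^2U^2\|_{L^2}+\||x||\nabla U|\|_{L^2}+\||x|U\|_{L^2}<\infty,\qquad \rho:=\|U\|_{L^2}^2 .$$ Let $C>0$ be a constant such that, for all $v\in H^1(\mathbb R^N,\mathbb C)$ with $\|v\|_{L^2}\le 1$, $$\Big|\int_{\mathbb R^N}\Big[f(|U+v|^2)(U+v)-f(U^2)U-(2f'(U^2)U^2+f(U^2))\Re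 v-i f(U^2)\Im v\Big]\,\overline{iU}\,dx\Big|\le C\,\|v\|_{L^2}$$ (the integrand being integrable); here, for a nonlocal $f$, $2f'(U^2)U^2\Re v$ stands for $U$ times the derivative of $f$ at $U^2$ in the direction $2U\Re v$. Let $V$ be a potential which is either (r) of class $C^2$ on $\mathbb R^N$, bounded from below, with bounded second derivatives; or (s) of class $C^2$ on $\mathbb R^N\setminus\{0\}$, with, for some $\zeta\in(0,2)$, $|V(x)|$ comparable to $|x|^{-\zeta}$ and $|\nabla V(x)|\lesssim|x|^{-\zeta-1}$ as $x\to0$, with $V\in L^m(\{|x|\ge1\})$ for some $m>\frac N2$, and $\nabla V(x)\to0$ as $|x|\to\infty$. Let $\sigma(t)=(a(t),\xi(t),\theta(t))$, $t\in\mathbb R$, solve $$\dot a=\xi,\qquad \dot\xi=-\frac2\rho\int_{\mathbb R^N}\nabla V(a+\varepsilon^\beta x)\,U^2(x)\,dx,\qquad \dot\theta=0$$ with $\sigma(0)=(a_0,\xi_0,\theta_0)$; in case (s) assume that $a(t)\ne0$ for all $t$. Let $\omega_\varepsilon$ solve $\dot\omega_\varepsilon=\varepsilon^{2-2\beta}\omega-\frac14|\xi(t)|^2+V(a(t))$,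 $\omega_\varepsilon(0)=0$, and put $$U_\sigma(x)=\varepsilon^\gamma U(\varepsilon^{-\beta}(x-a))\,e^{\frac i\varepsilon(\frac12(x-a)\cdot\xi+\theta)} .$$ Let $\psi$ be a solution, defined for all $t\in\mathbb R$, of $$i\varepsilon\psi_t+\varepsilon^2\Delta\psi-f(\varepsilon^{-2\alpha}|\psi|^2)\psi=V\psi,\qquad \psi(0)=U_{\sigma(0)},$$ continuous in $t$ with values in the energy space $X=\{u\in H^1:\int|V||u|^2<\infty\}$ and differentiable in $t$ with values in the dual $X^*$, the equation holding in $X^*$. Put $$w(t,x)=e^{\frac i\varepsilon\omega_\varepsilon(t)}\psi(t,x)-U_{\sigma(t)}(x),\qquad \tilde w(t,y)=\varepsilon^{-\gamma}e^{-\frac i\varepsilon(\frac12\varepsilon^\beta y\cdot\xi(t)+\theta(t))}\,w(t,a(t)+\varepsilon^\beta y),$$ $$\mathrm v(t)=\frac1\rho\int_{\mathbb R^N}\big(\nabla V(a(t)+\varepsilon^\beta x)-\nabla V(a(t))\big)U^2(x)\,dx,$$ $$\mathcal R_V(t,x)=V(a(t)+\varepsilon^\beta x)-V(a(t))-\varepsilon^\beta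 x\cdot\nabla V(a(t)).$$ If $\|\tilde w(t,\cdot)\|_{L^2}\le1$ (equivalently $\|w(t,\cdot)\|_{L^2}\le\varepsilon^{\gamma+\beta N/2}$) for all $t\in(0,\tau)$, then for all $t\in(0,\tau)$ the function $\|w(t,\cdot)\|_{L^2}^2$ is differentiable at $t$ and $$\Big|\partial_t\|w(t,\cdot)\|_{L^2}^2\Big|\le4\,\varepsilon^{\gamma+\beta\frac N2}\,\|w(t,\cdot)\|_{L^2}\Big(\tfrac12\varepsilon^{\beta-1}\||x|U\|_{L^2}\,|\mathrm v(t)|+\varepsilon^{-1}\big\||\mathcal R_V(t,\cdot)|\,U\big\|_{L^2}+\varepsilon^{1-2\beta}\,C\Big),$$ an inequality in $[0,\infty]$ with $0\cdot\infty=0$ (the norm containing $\mathcal R_V$ may be infinite). -/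

import Mathlib

open MeasureTheory Filter Topology
open scoped ComplexConjugate

noncomputable section

namespace SolitaryWave

/-- The Euclidean space of dimension `N`. -/
abbrev Space (N : ℕ) : Type := EuclideanSpace ℝ (Fin N)

variable {N : ℕ}

/-! ### The Sobolev space of order one, and the energy space of a potential -/

/-- `G` is the distributional gradient of `u` : the weak partial derivatives of `u` are the
coordinates of `G`. -/
def HasWeakGrad (u : Space N → ℂ) (G : Space N → EuclideanSpace ℂ (Fin N)) : Prop :=
  LocallyIntegrable u volume ∧ LocallyIntegrable G volume ∧
  ∀ φ : Space N → ℂ, ContDiff ℝ ((⊤ : ℕ∞) : WithTop ℕ∞) φ → HasCompactSupport φ → ∀ j : Fin N,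
    ∫ x, u x * fderiv ℝ φ x (EuclideanSpace.single j 1) = - ∫ x, G x j * φ x

/-- `u` is (a representative of) an element of `H¹`. -/
def MemH1 (u : Space N → ℂ) : Prop :=
  MemLp u 2 volume ∧ ∃ G, MemLp G 2 volume ∧ HasWeakGrad u G

open Classical in
/-- The weak gradient of an element of `H¹` (unique up to null sets). -/
def weakGrad (u : Space N → ℂ) : Space N → EuclideanSpace ℂ (Fin N) :=
  if h : ∃ G, MemLp G 2 volume ∧ HasWeakGrad u G then h.choose else 0

/-- The norm of `u` in `L²`. -/
def l2norm {F : Type*} [NormedAddCommGroup F] (u : Space N → F) : ℝ :=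
  (eLpNorm u 2 volume).toReal

/-- The energy space of `V` : the `u ∈ H¹` for which `|V| |u|²` is integrable. It is the whole
of `H¹` when `V` is bounded, or is singular in the sense of `SingularPotential` below. -/
def MemEnergy (V : Space N → ℝ) (u : Space N → ℂ) : Prop :=
  MemH1 u ∧ Integrable (fun x => |V x| * ‖u x‖ ^ 2) volume

/-- The norm of the energy space. -/
def energyNorm (V : Space N → ℝ) (u : Space N → ℂ) : ℝ :=
  Real.sqrt (l2norm u ^ 2 + l2norm (weakGrad u) ^ 2 + ∫ x, |V x| * ‖u x‖ ^ 2)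

/-- The pairing `∫ u conj(φ)`. -/
def pair (u φ : Space N → ℂ) : ℂ := ∫ x, u x * conj (φ x)

/-- The pairing `∫ ∇u · conj(∇φ)`. -/
def gradPair (u φ : Space N → ℂ) : ℂ := ∫ x, inner ℂ (weakGrad φ x) (weakGrad u x)

/-! ### The nonlinearity

A nonlinearity sends a density `r` (in the applications `r = |ψ|²`) to a real function `f r`;
a local nonlinearity, given by a function `g` of one real variable, is `f r = g ∘ r`. -/

/-- The type of nonlinearities. -/
abbrev Nonlinearity (N : ℕ) : Type := (Space N → ℝ) → Space N → ℝ

/-- `f` commutes with the changes of variable `x ↦ s (x - b)`. Every local nonlinearity does. -/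
def CommutesWithRescaling (f : Nonlinearity N) (s : ℝ) : Prop :=
  ∀ (b : Space N) (r : Space N → ℝ) (x : Space N),
    f (fun y => r (s • (y - b))) x = f r (s • (x - b))

/-- `f` is homogeneous of degree `p`. -/
def HomogeneousOfDegree (f : Nonlinearity N) (p : ℝ) : Prop :=
  ∀ (c : ℝ) (r : Space N → ℝ) (x : Space N), 0 < c →
    f (fun y => c * r y) x = c ^ p * f r x

/-- `2 f'(U²) U² Re v`, that is `U` times the directional derivative of `f` at `U²` in the
direction `2 U Re v`. For a local nonlinearity it is `2 g'(U²) U² Re v`. -/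
def linRe (f : Nonlinearity N) (U : Space N → ℝ) (v : Space N → ℂ) (x : Space N) : ℝ :=
  deriv (fun s : ℝ => f (fun y => U y ^ 2 + s * (2 * U y * (v y).re)) x) 0 * U x

/-- `f(|U+v|²)(U+v) - f(U²)U - (2f'(U²)U² + f(U²)) Re v - i f(U²) Im v`. -/
def nonlinRemainder (f : Nonlinearity N) (U : Space N → ℝ) (v : Space N → ℂ) (x : Space N) : ℂ :=
  (f (fun y => ‖(U y : ℂ) + v y‖ ^ 2) x : ℂ) * ((U x : ℂ) + v x)
    - (f (fun y => U y ^ 2) x : ℂ) * (U x : ℂ)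
    - ((linRe f U v x + f (fun y => U y ^ 2) x * (v x).re : ℝ) : ℂ)
    - Complex.I * ((f (fun y => U y ^ 2) x * (v x).im : ℝ) : ℂ)

/-- `C` is an admissible constant `C(φ, U)` in the estimate of the remainder. -/
def IsRemainderConst (f : Nonlinearity N) (U : Space N → ℝ) (φ : Space N → ℂ) (C : ℝ) : Prop :=
  0 < C ∧ ∀ v : Space N → ℂ, MemH1 v → l2norm v ≤ 1 →
    Integrable (fun x => nonlinRemainder f U v x * conj (φ x)) volume ∧
    ‖∫ x, nonlinRemainder f U v x * conj (φ x)‖ ≤ C * l2norm v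

/-! ### The profile -/

/-- `U` is a positive function in `H¹` and a weak solution of `-ΔU + f(U²)U - ωU = 0`. -/
structure IsProfile (f : Nonlinearity N) (ω : ℝ) (U : Space N → ℝ) : Prop where
  pos : ∀ x, 0 < U x
  memH1 : MemH1 (fun x => (U x : ℂ))
  integrable : ∀ φ : Space N → ℂ, MemH1 φ →
    Integrable (fun x => ((f (fun y => U y ^ 2) x * U x : ℝ) : ℂ) * conj (φ x)) volume
  equation : ∀ φ : Space N → ℂ, MemH1 φ →
    gradPair (fun x => (U x : ℂ)) φ
      + pair (fun x => ((f (fun y => U y ^ 2) x * U x : ℝ) : ℂ)) φ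
      - (ω : ℂ) * pair (fun x => (U x : ℂ)) φ = 0

/-- Boundedness and decay of the profile. -/
structure ProfileDecay (U : Space N → ℝ) : Prop where
  bounded : MemLp U ⊤ volume
  weighted_L1 : Integrable (fun x => ‖x‖ * U x ^ 2) volume
  weighted_sq : MemLp (fun x => ‖x‖ ^ 2 * U x ^ 2) 2 volume
  weighted_grad : MemLp (fun x => ‖x‖ * ‖weakGrad (fun y => (U y : ℂ)) x‖) 2 volume
  weighted_L2 : MemLp (fun x => ‖x‖ * U x) 2 volume

/-- The charge `ρ = ‖U‖²` of the profile. -/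
def charge (U : Space N → ℝ) : ℝ := ∫ x, U x ^ 2

/-- The element `U_σ` of the soliton manifold, `σ = (a, ξ, θ)`. -/
def solitary (ε β γ : ℝ) (U : Space N → ℝ) (a ξ : Space N) (θ : ℝ) (x : Space N) : ℂ :=
  ((ε ^ γ * U (ε ^ (-β) • (x - a)) : ℝ) : ℂ)
    * Complex.exp (Complex.I / (ε : ℂ) * ((1 / 2 * inner ℝ (x - a) ξ + θ : ℝ) : ℂ))

/-! ### The potential -/

/-- Regular potentials: of class `C²`, bounded below, with bounded second derivatives. -/
structure RegularPotential (V : Space N → ℝ) : Prop where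
  contDiff : ContDiff ℝ 2 V
  bddBelow : BddBelow (Set.range V)
  second_deriv : ∃ h : ℝ, ∀ x, ‖iteratedFDeriv ℝ 2 V x‖ ≤ h

/-- Potentials singular at the origin (the value of `V` at the origin is irrelevant). -/
structure SingularPotential (V : Space N → ℝ) : Prop where
  contDiffOn : ContDiffOn ℝ 2 V {0}ᶜ
  near_zero : ∃ ζ : ℝ, 0 < ζ ∧ ζ < 2 ∧
    (fun x => |V x|) =Θ[𝓝[≠] 0] (fun x => ‖x‖ ^ (-ζ)) ∧
    (fun x => gradient V x) =O[𝓝[≠] 0] (fun x => ‖x‖ ^ (-ζ - 1))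
  integrable_far : ∃ m : ℝ, (N : ℝ) / 2 < m ∧
    MemLp V (ENNReal.ofReal m) (volume.restrict {x | 1 ≤ ‖x‖})
  grad_far : Tendsto (gradient V) (cocompact (Space N)) (𝓝 0)

/-! ### The Schrödinger equation -/

/-- `f(ε^{-2α}|u|²) u`. -/
def nonlinTerm (ε α : ℝ) (f : Nonlinearity N) (u : Space N → ℂ) (x : Space N) : ℂ :=
  (f (fun y => ε ^ (-2 * α) * ‖u y‖ ^ 2) x : ℂ) * u x

/-- The action of `-ε²Δu + V u + f(ε^{-2α}|u|²) u` on `φ`. -/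
def weakForm (ε α : ℝ) (f : Nonlinearity N) (V : Space N → ℝ) (u φ : Space N → ℂ) : ℂ :=
  (ε : ℂ) ^ 2 * gradPair u φ + pair (fun x => (V x : ℂ) * u x) φ + pair (nonlinTerm ε α f u) φ

/-- `ψ` is a solution, for all times, of
`i ε ψ_t + ε² Δψ - f(ε^{-2α}|ψ|²)ψ = V ψ`, `ψ(0) = ψ₀` : it is continuous with values in the
energy space `X`, differentiable with respect to the norm of the dual space `X*`
(for the embedding of `X` in `X*` through `L²`), and the equation holds in `X*`. -/
structure IsSolution (ε α : ℝ) (f : Nonlinearity N) (V : Space N → ℝ)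
    (ψ₀ : Space N → ℂ) (ψ : ℝ → Space N → ℂ) : Prop where
  mem : ∀ t, MemEnergy V (ψ t)
  continuous : ∀ t, Tendsto (fun s => energyNorm V (fun x => ψ s x - ψ t x)) (𝓝 t) (𝓝 0)
  integrable : ∀ t, ∀ φ : Space N → ℂ, MemEnergy V φ →
    Integrable (fun x => nonlinTerm ε α f (ψ t) x * conj (φ x)) volume
  equation : ∀ t, ∀ η : ℝ, 0 < η → ∀ᶠ s in 𝓝 t, ∀ φ : Space N → ℂ, MemEnergy V φ →
    ‖Complex.I * (ε : ℂ) * (pair (ψ s) φ - pair (ψ t) φ)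
        - ((s - t : ℝ) : ℂ) * weakForm ε α f V (ψ t) φ‖ ≤ η * |s - t| * energyNorm V φ
  initial : ψ 0 =ᵐ[volume] ψ₀

/-! ### The effective dynamics and the error -/

/-- `(a, ξ, θ)` solves `a' = ξ`, `ξ' = -(2/ρ) ∫ ∇V(a + ε^β x) U²(x) dx`, `θ' = 0`, with initial
value `(a₀, ξ₀, θ₀)`. -/
structure IsEffectiveTrajectory (ε β : ℝ) (U V : Space N → ℝ) (a₀ ξ₀ : Space N) (θ₀ : ℝ)
    (a ξ : ℝ → Space N) (θ : ℝ → ℝ) : Prop where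
  deriv_a : ∀ t, HasDerivAt a (ξ t) t
  deriv_ξ : ∀ t, HasDerivAt ξ
    (-(2 / charge U) • ∫ x, U x ^ 2 • gradient V (a t + ε ^ β • x)) t
  deriv_θ : ∀ t, HasDerivAt θ 0 t
  initial_a : a 0 = a₀
  initial_ξ : ξ 0 = ξ₀
  initial_θ : θ 0 = θ₀

/-- `ω_ε' = ε^{2-2β} ω - |ξ|²/4 + V(a)`, `ω_ε(0) = 0`. -/
structure IsPhase (ε β ω : ℝ) (V : Space N → ℝ) (a ξ : ℝ → Space N) (ωε : ℝ → ℝ) : Prop where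
  deriv : ∀ t, HasDerivAt ωε (ε ^ (2 - 2 * β) * ω - 1 / 4 * ‖ξ t‖ ^ 2 + V (a t)) t
  initial : ωε 0 = 0

/-- `w = e^{iω_ε/ε} ψ - U_σ` at a fixed time. -/
def errorW (ε β γ : ℝ) (U : Space N → ℝ) (a ξ : Space N) (θ ωε : ℝ) (ψ : Space N → ℂ)
    (x : Space N) : ℂ :=
  Complex.exp (Complex.I / (ε : ℂ) * (ωε : ℂ)) * ψ x - solitary ε β γ U a ξ θ x

/-- The error in the moving frame,
`w̃(y) = ε^{-γ} e^{-(i/ε)(ε^β y·ξ/2 + θ)} w(a + ε^β y)`, at a fixed time. -/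
def errorTilde (ε β γ : ℝ) (U : Space N → ℝ) (a ξ : Space N) (θ ωε : ℝ) (ψ : Space N → ℂ)
    (y : Space N) : ℂ :=
  ((ε ^ (-γ) : ℝ) : ℂ)
    * Complex.exp (-(Complex.I / (ε : ℂ)) * ((1 / 2 * ε ^ β * inner ℝ y ξ + θ : ℝ) : ℂ))
    * errorW ε β γ U a ξ θ ωε ψ (a + ε ^ β • y)

/-- The vector `v = (1/ρ) ∫ (∇V(a + ε^β x) - ∇V(a)) U²(x) dx`. -/
def forceGap (ε β : ℝ) (U V : Space N → ℝ) (a : Space N) : Space N :=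
  (1 / charge U) • ∫ x, U x ^ 2 • (gradient V (a + ε ^ β • x) - gradient V a)

/-- The Taylor remainder `R_V(x) = V(a + ε^β x) - V(a) - ε^β x·∇V(a)`. -/
def taylorRemainder (ε β : ℝ) (V : Space N → ℝ) (a x : Space N) : ℝ :=
  V (a + ε ^ β • x) - V a - ε ^ β * inner ℝ x (gradient V a)

end SolitaryWave

end

open SolitaryWave

/-!
The error is compared with the solution in the gauge of the latter. Let `Z = e^{-iω_ε/ε} U_σ`; then
`‖w‖ = ‖ψ - Z‖`, so that `‖w‖² = ‖ψ‖² - 2 Re ⟨ψ, Z⟩ + ‖Z‖²`. The charge `‖ψ‖²` is conserved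
(`IsSolution.hasDerivAt_charge`) and `‖Z‖²` is constant, hence only the overlap `⟨ψ, Z⟩` has to be
differentiated. The solution is differentiable merely in the dual of the energy space, but `Z` is
differentiable in `L²` (`isLittleO_gaugedSolitary`): translations of functions of `H¹` are
differentiable in `L²` (`isLittleO_l2norm_translate`), and the finite variance of the profile takes
care of the phase. Together with the continuity of `ψ` in `L²` this suffices for the product rule
(`hasDerivAt_pair`).

In the moving frame `ψ` becomes `U + v`, where `v` is the rescaled error, and `Z` becomes `U`. The
change of frame is an affine change of variable followed by multiplication by a plane wave
(`boost`), whose effect on weak gradients and pairings is explicit. In the derivative of the overlap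
the terms with `ξ · ∇U` cancel, by integration by parts, and so do the kinetic energy of the center
and the value `V(a)`, by the choice of `ω_ε`; the equation for `ξ` removes the linear part of the
potential up to the force gap. What remains (`overlap_derivative_eq`) is the pairing of `U + v` with
`U` against `R_V - ε^β y · v(t)`, and the weak form of the profile equation with `f(|U + v|²)` in the
place of `f(U²)`. Only imaginary parts enter the derivative of `‖w‖²`. For the first term the
contribution of `U` itself is real, which leaves `Im v` and the Hölder inequality
(`ofReal_abs_im_effectivePotential_le`); for the second the profile equation tested with `U + v`
leaves the pairing of the remainder of the nonlinearity with `iU` (`abs_im_nonlinear_le`).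
-/

noncomputable section

namespace SolitaryWave

open scoped ENNReal Convolution

variable {N : ℕ} {F : Type*} [NormedAddCommGroup F]

/-! ### The `L²` norm and the `L²` pairing -/

lemma l2norm_nonneg (u : Space N → F) : 0 ≤ l2norm u := ENNReal.toReal_nonneg

lemma l2norm_congr_ae {E : Type*} [NormedAddCommGroup E] {u : Space N → F} {v : Space N → E}
    (h : ∀ᵐ x, ‖u x‖ = ‖v x‖) : l2norm u = l2norm v := by
  rw [l2norm, l2norm, eLpNorm_congr_norm_ae h]

lemma l2norm_eq_norm_toLp {u : Space N → F} (hu : MemLp u 2 volume) :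
    l2norm u = ‖hu.toLp u‖ := by
  rw [Lp.norm_toLp, l2norm]

lemma l2norm_sq {u : Space N → F} (hu : MemLp u 2 volume) :
    l2norm u ^ 2 = ∫ x, ‖u x‖ ^ 2 := by
  have h := hu.eLpNorm_eq_integral_rpow_norm (by norm_num) (by norm_num)
  rw [l2norm, h, ENNReal.toReal_ofReal (by positivity)]
  have h0 : 0 ≤ ∫ x, ‖u x‖ ^ 2 := integral_nonneg fun x => by positivity
  simp only [ENNReal.toReal_ofNat, Real.rpow_ofNat]
  rw [← Real.rpow_natCast, ← Real.rpow_mul h0]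
  norm_num

lemma l2norm_mono_ae {E : Type*} [NormedAddCommGroup E] {u : Space N → F} {v : Space N → E}
    (hv : MemLp v 2 volume) (h : ∀ᵐ x, ‖u x‖ ≤ ‖v x‖) : l2norm u ≤ l2norm v :=
  ENNReal.toReal_mono hv.eLpNorm_ne_top (eLpNorm_mono_ae h)

lemma l2norm_add_le {u v : Space N → F} (hu : MemLp u 2 volume) (hv : MemLp v 2 volume) :
    l2norm (fun x => u x + v x) ≤ l2norm u + l2norm v := by
  rw [l2norm_eq_norm_toLp hu, l2norm_eq_norm_toLp hv, show (fun x => u x + v x) = u + v from rfl,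
    l2norm_eq_norm_toLp (hu.add hv), MemLp.toLp_add]
  exact norm_add_le _ _

lemma l2norm_const_smul {𝕜 : Type*} [NormedField 𝕜] [NormedSpace 𝕜 F] (c : 𝕜) (u : Space N → F) :
    l2norm (fun x => c • u x) = ‖c‖ * l2norm u := by
  rw [l2norm, show (fun x => c • u x) = c • u from rfl, eLpNorm_const_smul, ENNReal.toReal_mul,
    toReal_enorm, l2norm]

lemma measurePreserving_add_const (h : Space N) :
    MeasurePreserving (fun x : Space N => x + h) volume volume :=
  measurePreserving_add_right volume h

lemma memLp_translate {u : Space N → F} (hu : MemLp u 2 volume) (h : Space N) :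
    MemLp (fun x => u (x + h)) 2 volume :=
  hu.comp_measurePreserving (measurePreserving_add_const h)

/-- Translations act continuously on `L²`. -/
lemma tendsto_l2norm_translate_sub {G : Space N → F} (hG : MemLp G 2 volume) :
    Tendsto (fun h : Space N => l2norm (fun x => G (x + h) - G x)) (𝓝 0) (𝓝 0) := by
  let c : C(Space N, C(Space N, Space N)) :=
    ContinuousMap.curry ⟨fun p : Space N × Space N => p.2 + p.1, by fun_prop⟩
  have hc : ∀ h, MeasurePreserving (c h) volume volume := fun h => measurePreserving_add_const h
  have h1 := Filter.Tendsto.compMeasurePreservingLp (f := fun _ : Space N => hG.toLp G)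
    tendsto_const_nhds (c.continuous.tendsto 0) hc (hc 0) (by norm_num)
  have h2 := (tendsto_iff_norm_sub_tendsto_zero.1 h1)
  refine h2.congr fun h => ?_
  rw [Lp.norm_def, l2norm]
  congr 1
  refine eLpNorm_congr_ae ?_
  filter_upwards [Lp.coeFn_sub (Lp.compMeasurePreserving (c h) (hc h) (hG.toLp G))
    (Lp.compMeasurePreserving (c 0) (hc 0) (hG.toLp G)),
    Lp.coeFn_compMeasurePreserving (hG.toLp G) (hc h),
    Lp.coeFn_compMeasurePreserving (hG.toLp G) (hc 0),
    (hc h).quasiMeasurePreserving.ae_eq_comp hG.coeFn_toLp,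
    (hc 0).quasiMeasurePreserving.ae_eq_comp hG.coeFn_toLp] with x h1 h2 h3 h4 h5
  rw [h1, Pi.sub_apply, h2, h3, h4, h5]
  simp [c]

lemma integrable_mul_conj {u φ : Space N → ℂ} (hu : MemLp u 2 volume) (hφ : MemLp φ 2 volume) :
    Integrable (fun x => u x * conj (φ x)) volume :=
  hu.integrable_mul (p := 2) (q := 2) hφ.star

lemma pair_eq_inner {u φ : Space N → ℂ} (hu : MemLp u 2 volume) (hφ : MemLp φ 2 volume) :
    pair u φ = inner ℂ (hφ.toLp φ) (hu.toLp u) := by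
  rw [L2.inner_def, pair]
  refine integral_congr_ae ?_
  filter_upwards [hu.coeFn_toLp, hφ.coeFn_toLp] with x h1 h2
  rw [h1, h2, RCLike.inner_apply]

lemma norm_pair_le {u φ : Space N → ℂ} (hu : MemLp u 2 volume) (hφ : MemLp φ 2 volume) :
    ‖pair u φ‖ ≤ l2norm u * l2norm φ := by
  rw [pair_eq_inner hu hφ, l2norm_eq_norm_toLp hu, l2norm_eq_norm_toLp hφ, mul_comm]
  exact norm_inner_le_norm _ _

lemma pair_conj_symm (u φ : Space N → ℂ) : conj (pair u φ) = pair φ u := by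
  rw [pair, pair, ← integral_conj]
  simp [mul_comm]

lemma pair_self {u : Space N → ℂ} (hu : MemLp u 2 volume) :
    pair u u = ((l2norm u ^ 2 : ℝ) : ℂ) := by
  rw [l2norm_sq hu, pair, ← integral_complex_ofReal]
  simp [Complex.mul_conj, Complex.normSq_eq_norm_sq]

lemma pair_sub_left {u v φ : Space N → ℂ} (hu : MemLp u 2 volume) (hv : MemLp v 2 volume)
    (hφ : MemLp φ 2 volume) : pair (fun x => u x - v x) φ = pair u φ - pair v φ := by
  rw [pair, pair, pair, ← integral_sub (integrable_mul_conj hu hφ) (integrable_mul_conj hv hφ)]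
  simp [sub_mul]

/-- A function of `L²` is bounded by `K` in norm if it is so as a functional on test functions. -/
lemma l2norm_le_of_forall_test {u : Space N → ℂ} (hu : MemLp u 2 volume) {K : ℝ}
    (hK : 0 ≤ K) (h : ∀ φ : Space N → ℂ, ContDiff ℝ ((⊤ : ℕ∞) : WithTop ℕ∞) φ → HasCompactSupport φ →
      ‖∫ x, u x * φ x‖ ≤ K * l2norm φ) : l2norm u ≤ K := by
  have hc : MemLp (fun x => conj (u x)) 2 volume := hu.star
  have hn : l2norm u = l2norm (fun x => conj (u x)) := l2norm_congr_ae (by simp)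
  -- approximate `conj u` by test functions and pass to the limit in the bound
  have key : ∀ δ : ℝ, 0 < δ → l2norm u ^ 2 ≤ K * l2norm u + (K + l2norm u) * δ := by
    intro δ hδ
    obtain ⟨φ, h1, h2, h3⟩ := hc.exist_eLpNorm_sub_le (by norm_num) (by norm_num) hδ
    have hφ : MemLp φ 2 volume := h2.continuous.memLp_of_hasCompactSupport h1
    have hd : MemLp (fun x => conj (u x) - φ x) 2 volume := hc.sub hφ
    have hdn : l2norm (fun x => conj (u x) - φ x) ≤ δ :=
      ENNReal.toReal_le_of_le_ofReal hδ.le h3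
    have e1 : ((l2norm u ^ 2 : ℝ) : ℂ)
        = (∫ x, u x * φ x) + pair u (fun x => u x - conj (φ x)) := by
      rw [← pair_self hu, pair, pair, ← integral_add]
      · congr 1; ext x; simp; ring
      · exact hu.integrable_mul (p := 2) (q := 2) hφ
      · exact integrable_mul_conj hu (hu.sub hφ.star)
    have e2 : l2norm (fun x => u x - conj (φ x)) = l2norm (fun x => conj (u x) - φ x) := by
      refine l2norm_congr_ae (.of_forall fun x => ?_)
      rw [← RCLike.norm_conj]; simp
    have e3 : l2norm φ ≤ l2norm u + δ := by
      have : l2norm φ ≤ l2norm (fun x => φ x - conj (u x)) + l2norm (fun x => conj (u x)) := by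
        have := l2norm_add_le (hφ.sub hc) hc
        simp only [Pi.sub_apply, sub_add_cancel] at this
        exact this
      rw [← hn] at this
      have e4 : l2norm (fun x => φ x - conj (u x)) = l2norm (fun x => conj (u x) - φ x) :=
        l2norm_congr_ae (.of_forall fun x => norm_sub_rev _ _)
      linarith
    have e6 : l2norm u ^ 2 ≤ K * l2norm φ + l2norm u * δ := by
      calc l2norm u ^ 2 = ‖((l2norm u ^ 2 : ℝ) : ℂ)‖ := by
            rw [Complex.norm_real, Real.norm_of_nonneg (by positivity)]
        _ ≤ _ := by
            rw [e1]
            refine (norm_add_le _ _).trans (add_le_add (h φ h2 h1) ?_)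
            refine (norm_pair_le hu (hu.sub hφ.star)).trans ?_
            change l2norm u * l2norm (fun x => u x - conj (φ x)) ≤ _
            rw [e2]
            exact mul_le_mul_of_nonneg_left hdn (l2norm_nonneg u)
    have e7 : K * l2norm φ ≤ K * (l2norm u + δ) := mul_le_mul_of_nonneg_left e3 hK
    linarith
  have h0 := l2norm_nonneg u
  have hsq : l2norm u ^ 2 ≤ K * l2norm u := by
    refine le_of_forall_pos_le_add fun η hη => ?_
    have hp : 0 < K + l2norm u + 1 := by linarith
    have := key (η / (K + l2norm u + 1)) (by positivity)
    refine this.trans (add_le_add le_rfl ?_)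
    rw [mul_div_assoc', div_le_iff₀ hp]
    nlinarith
  rcases h0.eq_or_lt with h1 | h1
  · rwa [← h1]
  · nlinarith

/-! ### Affine changes of variable -/

lemma quasiMeasurePreserving_affine (b : Space N) {s : ℝ} (hs : s ≠ 0) :
    Measure.QuasiMeasurePreserving (fun x : Space N => b + s • x) volume volume := by
  refine (measurePreserving_add_left volume b).quasiMeasurePreserving.comp
    ⟨measurable_const_smul s, ?_⟩
  rw [Measure.map_addHaar_smul volume hs]
  exact Measure.smul_absolutelyContinuous

lemma integral_comp_affine {E : Type*} [NormedAddCommGroup E] [NormedSpace ℝ E]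
    (F : Space N → E) (b : Space N) (s : ℝ) :
    ∫ x, F (b + s • x) = (|s| ^ N)⁻¹ • ∫ x, F x := by
  rw [Measure.integral_comp_smul volume (fun y => F (b + y)) s, integral_add_left_eq_self]
  simp [abs_inv]

lemma memLp_comp_affine {p : ℝ≥0∞} {u : Space N → F} (hu : MemLp u p volume) (b : Space N) {s : ℝ}
    (hs : s ≠ 0) : MemLp (fun x => u (b + s • x)) p volume := by
  have h1 : MemLp (fun y => u (b + y)) p volume :=
    hu.comp_measurePreserving (measurePreserving_add_left volume b)
  have h2 : MemLp (fun y => u (b + y)) p (Measure.map (fun x : Space N => s • x) volume) := by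
    rw [Measure.map_addHaar_smul volume hs]
    exact h1.smul_measure ENNReal.ofReal_ne_top
  exact h2.comp_of_map (measurable_const_smul s).aemeasurable

lemma integrable_comp_affine {u : Space N → F} (hu : Integrable u volume) (b : Space N) {s : ℝ}
    (hs : s ≠ 0) : Integrable (fun x => u (b + s • x)) volume :=
  memLp_one_iff_integrable.1 (memLp_comp_affine (memLp_one_iff_integrable.2 hu) b hs)

/-! ### Weak gradients -/

/-- The complexification of a real vector. -/
def toC : Space N →ₗᵢ[ℝ] EuclideanSpace ℂ (Fin N) where
  toFun h := WithLp.toLp 2 fun j => (h j : ℂ)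
  map_add' x y := by ext j; simp
  map_smul' c x := by ext j; simp
  norm_map' x := by simp [EuclideanSpace.norm_eq]

@[simp] lemma toC_apply (h : Space N) (j : Fin N) : toC h j = (h j : ℂ) := rfl

lemma inner_toC_toC (h k : Space N) : inner ℂ (toC h) (toC k) = ((inner ℝ h k : ℝ) : ℂ) := by
  simp [PiLp.inner_apply]

/-- `u` belongs to `H¹` and `G` is its weak gradient; the test is made with the derivatives of the
test function in all the directions `h`, not only in those of the axes. -/
structure HasGradL2 (u : Space N → ℂ) (G : Space N → EuclideanSpace ℂ (Fin N)) : Prop where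
  memLp : MemLp u 2 volume
  memLp_grad : MemLp G 2 volume
  integral_eq : ∀ φ : Space N → ℂ, ContDiff ℝ ((⊤ : ℕ∞) : WithTop ℕ∞) φ → HasCompactSupport φ →
    ∀ h : Space N, ∫ x, u x * fderiv ℝ φ x h = - ∫ x, inner ℂ (toC h) (G x) * φ x

lemma memLp_test {E : Type*} [NormedAddCommGroup E] {φ : Space N → E} (h : Continuous φ)
    (h' : HasCompactSupport φ) (p : ℝ≥0∞) : MemLp φ p volume :=
  h.memLp_of_hasCompactSupport h'

lemma memLp_fderiv_test {φ : Space N → ℂ} (h : ContDiff ℝ ((⊤ : ℕ∞) : WithTop ℕ∞) φ)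
    (h' : HasCompactSupport φ) (v : Space N) (p : ℝ≥0∞) :
    MemLp (fun x => fderiv ℝ φ x v) p volume :=
  memLp_test ((h.continuous_fderiv (by simp)).clm_apply continuous_const)
    (h'.fderiv_apply ℝ v) p

lemma inner_toC (h : Space N) (z : EuclideanSpace ℂ (Fin N)) :
    inner ℂ (toC h) z = ∑ j, (h j : ℂ) * z j := by
  simp [PiLp.inner_apply, mul_comm]

lemma HasGradL2.hasWeakGrad {u : Space N → ℂ} {G : Space N → EuclideanSpace ℂ (Fin N)}
    (h : HasGradL2 u G) : HasWeakGrad u G := by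
  refine ⟨h.memLp.locallyIntegrable (by norm_num), h.memLp_grad.locallyIntegrable (by norm_num),
    fun φ h1 h2 j => ?_⟩
  rw [h.integral_eq φ h1 h2]
  congr 1
  refine integral_congr_ae (.of_forall fun x => ?_)
  simp [inner_toC, apply_ite (fun r : ℝ => (r : ℂ))]

lemma HasGradL2.memH1 {u : Space N → ℂ} {G : Space N → EuclideanSpace ℂ (Fin N)}
    (h : HasGradL2 u G) : MemH1 u :=
  ⟨h.memLp, G, h.memLp_grad, h.hasWeakGrad⟩

lemma MemH1.hasGradL2 {u : Space N → ℂ} (h : MemH1 u) : HasGradL2 u (weakGrad u) := by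
  have hG : MemLp (weakGrad u) 2 volume ∧ HasWeakGrad u (weakGrad u) := by
    rw [weakGrad, dif_pos h.2]
    exact h.2.choose_spec
  refine ⟨h.1, hG.1, fun φ h1 h2 v => ?_⟩
  have e1 : ∀ x, fderiv ℝ φ x v = ∑ j, (v j : ℂ) * fderiv ℝ φ x (EuclideanSpace.single j 1) := by
    intro x
    conv_lhs => rw [← (EuclideanSpace.basisFun (Fin N) ℝ).sum_repr v]
    simp
  have hGj : ∀ j, MemLp (fun x => weakGrad u x j) 2 volume := fun j =>
    hG.1.continuousLinearMap_comp (EuclideanSpace.proj (𝕜 := ℂ) j)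
  simp only [e1, inner_toC, Finset.mul_sum, Finset.sum_mul]
  rw [integral_finsetSum, integral_finsetSum, ← Finset.sum_neg_distrib]
  · refine Finset.sum_congr rfl fun j _ => ?_
    simp only [mul_assoc, mul_left_comm (u _)]
    rw [integral_const_mul, integral_const_mul, hG.2.2.2 φ h1 h2 j, mul_neg]
  · intro j _
    simp only [mul_assoc]
    exact ((hGj j).integrable_mul (p := 2) (q := 2) (memLp_test h1.continuous h2 2)).const_mul _
  · intro j _
    simp only [mul_left_comm (u _)]
    exact (h.1.integrable_mul (p := 2) (q := 2) (memLp_fderiv_test h1 h2 _ 2)).const_mul _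

lemma HasGradL2.weakGrad_ae_eq {u : Space N → ℂ} {G : Space N → EuclideanSpace ℂ (Fin N)}
    (h : HasGradL2 u G) : weakGrad u =ᵐ[volume] G := by
  have h' := h.memH1.hasGradL2
  have hj : ∀ {H : Space N → EuclideanSpace ℂ (Fin N)}, MemLp H 2 volume → ∀ j,
      LocallyIntegrable (fun x => H x j) volume := fun hH j =>
    (hH.continuousLinearMap_comp (EuclideanSpace.proj (𝕜 := ℂ) j)).locallyIntegrable (by norm_num)
  have key : ∀ j, ∀ᵐ x, weakGrad u x j = G x j := fun j => by
    refine ae_eq_of_integral_contDiff_smul_eq (hj h'.memLp_grad j) (hj h.memLp_grad j)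
      fun g h1 h2 => ?_
    have hg : ContDiff ℝ ((⊤ : ℕ∞) : WithTop ℕ∞) (fun x => (g x : ℂ)) :=
      Complex.ofRealCLM.contDiff.comp h1
    have hg2 : HasCompactSupport (fun x => (g x : ℂ)) :=
      h2.comp_left (g := fun r : ℝ => (r : ℂ)) (by simp)
    have e := (h'.hasWeakGrad.2.2 _ hg hg2 j).symm.trans (h.hasWeakGrad.2.2 _ hg hg2 j)
    simpa [mul_comm] using e
  filter_upwards [ae_all_iff.2 key] with x hx
  ext j
  exact hx j

lemma integrable_inner_mul_test {G : Space N → EuclideanSpace ℂ (Fin N)} (hG : MemLp G 2 volume)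
    {φ : Space N → ℂ} (hφ : MemLp φ 2 volume) (h : Space N) :
    Integrable (fun x => inner ℂ (toC h) (G x) * φ x) volume :=
  (hG.const_inner (toC h)).integrable_mul (p := 2) (q := 2) hφ

lemma HasGradL2.sub {u v : Space N → ℂ} {G H : Space N → EuclideanSpace ℂ (Fin N)}
    (hu : HasGradL2 u G) (hv : HasGradL2 v H) :
    HasGradL2 (fun x => u x - v x) (fun x => G x - H x) := by
  refine ⟨hu.memLp.sub hv.memLp, hu.memLp_grad.sub hv.memLp_grad, fun φ h1 h2 k => ?_⟩
  have hd := memLp_fderiv_test h1 h2 k 2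
  have ht := memLp_test h1.continuous h2 2
  simp only [sub_mul, inner_sub_right]
  have iu : Integrable (fun x => u x * fderiv ℝ φ x k) volume :=
    hu.memLp.integrable_mul (p := 2) (q := 2) hd
  have iv : Integrable (fun x => v x * fderiv ℝ φ x k) volume :=
    hv.memLp.integrable_mul (p := 2) (q := 2) hd
  rw [integral_sub iu iv,
    integral_sub (integrable_inner_mul_test hu.memLp_grad ht k)
      (integrable_inner_mul_test hv.memLp_grad ht k),
    hu.integral_eq φ h1 h2 k, hv.integral_eq φ h1 h2 k]
  ring

/-- The function `u` after an affine change of variable, multiplied by a plane wave of amplitude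
`c` and wave vector `k`. Both the soliton manifold and the passage to the moving frame are
of this form. -/
def boost (c : ℂ) (k b : Space N) (s : ℝ) (u : Space N → ℂ) (x : Space N) : ℂ :=
  c * Complex.exp (Complex.I * ((inner ℝ x k : ℝ) : ℂ)) * u (b + s • x)

/-- The weak gradient of `boost c k b s u`, given that of `u`. -/
def boostGrad (c : ℂ) (k b : Space N) (s : ℝ) (u : Space N → ℂ)
    (G : Space N → EuclideanSpace ℂ (Fin N)) (x : Space N) : EuclideanSpace ℂ (Fin N) :=
  (c * Complex.exp (Complex.I * ((inner ℝ x k : ℝ) : ℂ))) •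
    ((s : ℂ) • G (b + s • x) + (Complex.I * u (b + s • x)) • toC k)

lemma continuous_wave (k : Space N) :
    Continuous fun x : Space N => Complex.exp (Complex.I * ((inner ℝ x k : ℝ) : ℂ)) := by
  fun_prop

lemma memLp_wave_smul {E : Type*} [NormedAddCommGroup E] [NormedSpace ℂ E] {p : ℝ≥0∞}
    {u : Space N → E} (hu : MemLp u p volume) (c : ℂ) (k : Space N) :
    MemLp (fun x => (c * Complex.exp (Complex.I * ((inner ℝ x k : ℝ) : ℂ))) • u x) p volume := by
  refine (hu.const_smul c).congr_norm
    (((continuous_wave k).const_mul c).aestronglyMeasurable.smul hu.1) (.of_forall fun x => ?_)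
  simp [norm_smul]

lemma memLp_boost {p : ℝ≥0∞} {u : Space N → ℂ} (hu : MemLp u p volume) (c : ℂ) (k b : Space N)
    {s : ℝ} (hs : s ≠ 0) : MemLp (boost c k b s u) p volume :=
  memLp_wave_smul (memLp_comp_affine hu b hs) c k

lemma HasGradL2.boost {u : Space N → ℂ} {G : Space N → EuclideanSpace ℂ (Fin N)}
    (hu : HasGradL2 u G) (c : ℂ) (k b : Space N) {s : ℝ} (hs : s ≠ 0) :
    HasGradL2 (boost c k b s u) (boostGrad c k b s u G) := by
  have mu := memLp_comp_affine hu.memLp b hs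
  have mG := memLp_comp_affine hu.memLp_grad b hs
  refine ⟨memLp_boost hu.memLp c k b hs, memLp_wave_smul ((mG.const_smul (s : ℂ)).add ?_) c k,
    fun φ h1 h2 h => ?_⟩
  · exact (memLp_top_const (toC k)).smul (mu.const_mul Complex.I)
  set e : Space N → ℂ := fun x => Complex.exp (Complex.I * ((inner ℝ x k : ℝ) : ℂ)) with he
  have hesm : ContDiff ℝ ((⊤ : ℕ∞) : WithTop ℕ∞) e := by
    refine Complex.contDiff_exp.comp (contDiff_const.mul (Complex.ofRealCLM.contDiff.comp ?_))
    exact contDiff_id.inner ℝ contDiff_const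
  -- the test function of the undone transformation
  set χ : Space N → ℂ := fun x => e x * φ x with hχ
  have hχ1 : ContDiff ℝ ((⊤ : ℕ∞) : WithTop ℕ∞) χ := hesm.mul h1
  have hχ2 : HasCompactSupport χ := h2.mul_left
  set η : Space N → ℂ := fun y => χ (s⁻¹ • (y - b)) with hη
  have hη1 : ContDiff ℝ ((⊤ : ℕ∞) : WithTop ℕ∞) η :=
    hχ1.comp ((contDiff_id.sub contDiff_const).const_smul s⁻¹)
  have hη2 : HasCompactSupport η := by
    have := hχ2.comp_homeomorph ((Homeomorph.subRight b).trans
      (Homeomorph.smulOfNeZero s⁻¹ (inv_ne_zero hs)))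
    exact this
  have hde : ∀ x, HasFDerivAt e (e x • (Complex.I • (Complex.ofRealCLM.comp
      ((innerSL ℝ).flip k)))) x := by
    intro x
    have h0 : HasFDerivAt (fun x : Space N => ((inner ℝ x k : ℝ) : ℂ))
        (Complex.ofRealCLM.comp ((innerSL ℝ).flip k)) x :=
      (Complex.ofRealCLM.comp ((innerSL ℝ).flip k)).hasFDerivAt
    exact (h0.const_mul Complex.I).cexp
  have hdχ : ∀ x, fderiv ℝ χ x h
      = e x * fderiv ℝ φ x h + Complex.I * ((inner ℝ h k : ℝ) : ℂ) * χ x := by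
    intro x
    have := ((hde x).mul ((h1.differentiable (by simp)) x).hasFDerivAt).fderiv
    rw [hχ, show (fun x => e x * φ x) = e * φ from rfl, this]
    have hi : (innerSL ℝ) k h = inner ℝ h k := by
      rw [innerSL_apply_apply]; exact real_inner_comm _ _
    simp [hi]
    ring
  have hdη : ∀ x, (s : ℂ) * fderiv ℝ η (b + s • x) h = fderiv ℝ χ x h := by
    intro x
    have hin : HasFDerivAt (fun y : Space N => s⁻¹ • (y - b))
        (s⁻¹ • ContinuousLinearMap.id ℝ (Space N)) (b + s • x) :=
      ((hasFDerivAt_id _).sub_const b).const_smul s⁻¹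
    have hx : s⁻¹ • (b + s • x - b) = x := by simp [smul_smul, hs]
    have hc : HasFDerivAt χ (fderiv ℝ χ x) (s⁻¹ • (b + s • x - b)) := by
      rw [hx]; exact ((hχ1.differentiable (by simp)) x).hasFDerivAt
    have := (HasFDerivAt.comp (g := χ) (b + s • x) hc hin).fderiv
    rw [show χ ∘ (fun y : Space N => s⁻¹ • (y - b)) = η from rfl] at this
    rw [this]
    simp [hs]
  have key : ∫ x, u (b + s • x) * fderiv ℝ χ x h
      = - ∫ x, (s : ℂ) * inner ℂ (toC h) (G (b + s • x)) * χ x := by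
    have a1 := integral_comp_affine (fun y => u y * fderiv ℝ η y h) b s
    have a2 := integral_comp_affine (fun y => inner ℂ (toC h) (G y) * η y) b s
    rw [hu.integral_eq η hη1 hη2 h, smul_neg, ← a2] at a1
    have a3 : ∀ x, η (b + s • x) = χ x := fun x => by simp [hη, smul_smul, hs]
    simp only [a3] at a1
    calc ∫ x, u (b + s • x) * fderiv ℝ χ x h
        = (s : ℂ) * ∫ x, u (b + s • x) * fderiv ℝ η (b + s • x) h := by
          rw [← integral_const_mul]
          refine integral_congr_ae (.of_forall fun x => ?_)
          simp only [← hdη x]; ring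
      _ = _ := by
          rw [a1, mul_neg, ← integral_const_mul]
          simp only [mul_assoc]
  have i1 : Integrable (fun x => u (b + s • x) * fderiv ℝ χ x h) volume :=
    mu.integrable_mul (p := 2) (q := 2) (memLp_fderiv_test hχ1 hχ2 h 2)
  have i2 : Integrable (fun x => u (b + s • x) * (Complex.I * ((inner ℝ h k : ℝ) : ℂ) * χ x))
      volume :=
    mu.integrable_mul (p := 2) (q := 2) ((memLp_test hχ1.continuous hχ2 2).const_mul _)
  have i3 : Integrable (fun x => (s : ℂ) * inner ℂ (toC h) (G (b + s • x)) * χ x) volume := by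
    simp only [mul_assoc]
    exact (integrable_inner_mul_test mG (memLp_test hχ1.continuous hχ2 2) h).const_mul _
  calc ∫ x, SolitaryWave.boost c k b s u x * fderiv ℝ φ x h
      = c * ∫ x, (u (b + s • x) * fderiv ℝ χ x h
          - u (b + s • x) * (Complex.I * ((inner ℝ h k : ℝ) : ℂ) * χ x)) := by
        rw [← integral_const_mul]
        refine integral_congr_ae (.of_forall fun x => ?_)
        simp only [hdχ x, SolitaryWave.boost, he]; ring
    _ = - (c * ∫ x, ((s : ℂ) * inner ℂ (toC h) (G (b + s • x)) * χ x
          + u (b + s • x) * (Complex.I * ((inner ℝ h k : ℝ) : ℂ) * χ x))) := by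
        rw [integral_sub i1 i2, integral_add i3 i2, key]; ring
    _ = _ := by
        rw [← integral_const_mul]
        congr 1
        refine integral_congr_ae (.of_forall fun x => ?_)
        simp only [boostGrad, inner_smul_right, inner_add_right, inner_toC_toC, hχ, he]; ring

/-! ### Differentiability of translations in `L²`, and integration by parts -/

lemma norm_inner_toC_le (h : Space N) (z : EuclideanSpace ℂ (Fin N)) :
    ‖inner ℂ (toC h) z‖ ≤ ‖h‖ * ‖z‖ := by
  simpa using norm_inner_le_norm (𝕜 := ℂ) (toC h) z

lemma l2norm_inner_toC_le {G : Space N → EuclideanSpace ℂ (Fin N)} (hG : MemLp G 2 volume)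
    (h : Space N) : l2norm (fun x => inner ℂ (toC h) (G x)) ≤ ‖h‖ * l2norm G := by
  rw [show ‖h‖ * l2norm G = l2norm (fun x => ‖h‖ • G x) by
    rw [l2norm_const_smul, norm_norm]]
  refine l2norm_mono_ae (hG.const_smul ‖h‖) (.of_forall fun x => ?_)
  rw [norm_smul, norm_norm]
  exact norm_inner_toC_le h (G x)

lemma norm_integral_mul_le {u φ : Space N → ℂ} (hu : MemLp u 2 volume) (hφ : MemLp φ 2 volume) :
    ‖∫ x, u x * φ x‖ ≤ l2norm u * l2norm φ := by
  have h := norm_pair_le hu hφ.star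
  rw [pair] at h
  rw [show l2norm φ = l2norm (star φ) from l2norm_congr_ae (.of_forall fun x => by simp)]
  simpa using h

lemma hasDerivAt_integral_translate {u : Space N → ℂ} {G : Space N → EuclideanSpace ℂ (Fin N)}
    (hu : HasGradL2 u G) {φ : Space N → ℂ} (h1 : ContDiff ℝ ((⊤ : ℕ∞) : WithTop ℕ∞) φ)
    (h2 : HasCompactSupport φ) (h : Space N) (r : ℝ) :
    HasDerivAt (fun r : ℝ => ∫ x, u (x + r • h) * φ x)
      (∫ x, inner ℂ (toC h) (G (x + r • h)) * φ x) r := by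
  -- in terms of `g = φ(-·)` the function is the convolution `u ⋆ g` along a line
  set g : Space N → ℂ := fun y => φ (-y) with hg
  have hg1 : ContDiff ℝ ((⊤ : ℕ∞) : WithTop ℕ∞) g := h1.comp contDiff_neg
  have hg2 : HasCompactSupport g := h2.comp_homeomorph (Homeomorph.neg (Space N))
  have hul : LocallyIntegrable u volume := hu.memLp.locallyIntegrable (by norm_num)
  have hd := hg2.hasFDerivAt_convolution_right (ContinuousLinearMap.mul ℝ ℂ) hul
    (hg1.of_le (by simp)) (r • h)
  have hline : HasDerivAt (fun r : ℝ => r • h) h r := by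
    simpa using (hasDerivAt_id r).smul_const h
  have hd2 := hd.comp_hasDerivAt r hline
  have e1 : ∀ r : ℝ, (u ⋆[ContinuousLinearMap.mul ℝ ℂ, volume] g) (r • h)
      = ∫ x, u (x + r • h) * φ x := by
    intro r
    rw [convolution_def, ← integral_add_right_eq_self _ (r • h)]
    simp [hg]
  have e2 : ((u ⋆[(ContinuousLinearMap.mul ℝ ℂ).precompR (Space N), volume] fderiv ℝ g) (r • h)) h
      = ∫ x, inner ℂ (toC h) (G (x + r • h)) * φ x := by
    rw [convolution_precompR_apply (ContinuousLinearMap.mul ℝ ℂ) hul (hg2.fderiv ℝ) (hg1.continuous_fderiv (by simp)),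
      convolution_def]
    have ht1 : ContDiff ℝ ((⊤ : ℕ∞) : WithTop ℕ∞) (fun x => φ (x - r • h)) :=
      h1.comp (contDiff_id.sub contDiff_const)
    have ht2 : HasCompactSupport (fun x => φ (x - r • h)) :=
      h2.comp_homeomorph (Homeomorph.subRight (r • h))
    have e3 := hu.integral_eq _ ht1 ht2 h
    rw [← integral_add_right_eq_self (fun x => inner ℂ (toC h) (G x) * φ (x - r • h)) (r • h)] at e3
    simp only [add_sub_cancel_right] at e3
    rw [← neg_eq_iff_eq_neg] at e3
    rw [← e3, ← integral_neg]
    refine integral_congr_ae (.of_forall fun x => ?_)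
    have e4 : fderiv ℝ g (r • h - x) h = - fderiv ℝ φ (x - r • h) h := by
      have hφ : HasFDerivAt φ (fderiv ℝ φ (x - r • h)) (-(r • h - x)) := by
        rw [neg_sub]; exact (h1.differentiable (by simp) _).hasFDerivAt
      have hn : HasFDerivAt (fun y : Space N => -y) (-ContinuousLinearMap.id ℝ (Space N))
          (r • h - x) := (hasFDerivAt_id _).neg
      have hgd : HasFDerivAt g _ (r • h - x) := HasFDerivAt.comp (g := φ) (r • h - x) hφ hn
      rw [hgd.fderiv]
      simp
    have e5 : fderiv ℝ (fun x => φ (x - r • h)) x = fderiv ℝ φ (x - r • h) := by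
      rw [fderiv_comp_sub]
    simp [e4, e5]
  rw [e2] at hd2
  refine hd2.congr_of_eventuallyEq (.of_forall fun r => ?_)
  exact (e1 r).symm

/-- The first order expansion of a translation in `L²`, with the modulus of continuity of the
gradient in the remainder. -/
lemma l2norm_translate_sub_grad_le {u : Space N → ℂ} {G : Space N → EuclideanSpace ℂ (Fin N)}
    (hu : HasGradL2 u G) (h : Space N) {δ : ℝ}
    (hδ : ∀ r ∈ Set.Icc (0 : ℝ) 1, l2norm (fun x => G (x + r • h) - G x) ≤ δ) :
    l2norm (fun x => u (x + h) - u x - inner ℂ (toC h) (G x)) ≤ ‖h‖ * δ := by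
  have hδ0 : 0 ≤ δ := (l2norm_nonneg _).trans (hδ 0 (by simp))
  have mG := hu.memLp_grad.const_inner (𝕜 := ℂ) (toC h)
  have mu := memLp_translate hu.memLp h
  refine l2norm_le_of_forall_test ((mu.sub hu.memLp).sub mG) (by positivity) fun φ h1 h2 => ?_
  have mφ := memLp_test h1.continuous h2 2
  set A : ℂ := ∫ x, inner ℂ (toC h) (G x) * φ x with hA
  have hder : ∀ r : ℝ, HasDerivAt (fun r : ℝ => (∫ x, u (x + r • h) * φ x) - r • A)
      ((∫ x, inner ℂ (toC h) (G (x + r • h)) * φ x) - A) r := by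
    intro r
    have h0 : HasDerivAt (fun r : ℝ => r • A) A r := by
      simpa using (hasDerivAt_id r).smul_const A
    exact (hasDerivAt_integral_translate hu h1 h2 h r).sub h0
  have hb : ∀ r ∈ Set.Ico (0 : ℝ) 1,
      ‖(∫ x, inner ℂ (toC h) (G (x + r • h)) * φ x) - A‖ ≤ ‖h‖ * δ * l2norm φ := by
    intro r hr
    have mGr := memLp_translate hu.memLp_grad (r • h)
    rw [hA, ← integral_sub (integrable_inner_mul_test mGr mφ h)
      (integrable_inner_mul_test hu.memLp_grad mφ h)]
    simp only [← sub_mul, ← inner_sub_right]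
    refine (norm_integral_mul_le ((mGr.sub hu.memLp_grad).const_inner (toC h)) mφ).trans ?_
    refine mul_le_mul_of_nonneg_right ?_ (l2norm_nonneg φ)
    refine (l2norm_inner_toC_le (mGr.sub hu.memLp_grad) h).trans ?_
    exact mul_le_mul_of_nonneg_left (hδ r ⟨hr.1, hr.2.le⟩) (norm_nonneg h)
  have := norm_image_sub_le_of_norm_deriv_le_segment_01'
    (fun r _ => (hder r).hasDerivWithinAt) hb
  have i1 : Integrable (fun x => u (x + h) * φ x) volume := mu.integrable_mul (p := 2) (q := 2) mφ
  have i2 : Integrable (fun x => u x * φ x) volume :=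
    hu.memLp.integrable_mul (p := 2) (q := 2) mφ
  have i3 := integrable_inner_mul_test hu.memLp_grad mφ h
  have e : ∫ x, (u (x + h) - u x - inner ℂ (toC h) (G x)) * φ x
      = (∫ x, u (x + (1 : ℝ) • h) * φ x) - (1 : ℝ) • A
        - ((∫ x, u (x + (0 : ℝ) • h) * φ x) - (0 : ℝ) • A) := by
    have i12 : Integrable (fun x => u (x + h) * φ x - u x * φ x) volume := i1.sub i2
    simp only [sub_mul, one_smul, zero_smul, add_zero, sub_zero]
    rw [integral_sub i12 i3, integral_sub i1 i2]
    ring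
  change ‖∫ x, (u (x + h) - u x - inner ℂ (toC h) (G x)) * φ x‖ ≤ _
  rw [e]
  linarith

/-- Translations of a function of `H¹` are differentiable in `L²`. -/
lemma isLittleO_l2norm_translate {u : Space N → ℂ} {G : Space N → EuclideanSpace ℂ (Fin N)}
    (hu : HasGradL2 u G) :
    (fun h : Space N => l2norm (fun x => u (x + h) - u x - inner ℂ (toC h) (G x)))
      =o[𝓝 0] (fun h => h) := by
  rw [Asymptotics.isLittleO_iff]
  intro δ hδ
  have h1 := (tendsto_l2norm_translate_sub hu.memLp_grad).eventually (gt_mem_nhds hδ)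
  obtain ⟨η, hη, h2⟩ := Metric.eventually_nhds_iff.1 h1
  filter_upwards [Metric.ball_mem_nhds (0 : Space N) hη] with h hh
  rw [Real.norm_of_nonneg (l2norm_nonneg _), mul_comm]
  refine l2norm_translate_sub_grad_le hu h fun r hr => (h2 ?_).le
  rw [dist_zero_right, norm_smul, Real.norm_of_nonneg hr.1]
  have := mem_ball_zero_iff.1 hh
  nlinarith [norm_nonneg h, hr.1, hr.2]

lemma hasDerivAt_pair_translate {u v : Space N → ℂ} {G : Space N → EuclideanSpace ℂ (Fin N)}
    (hu : HasGradL2 u G) (hv : MemLp v 2 volume) (h : Space N) :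
    HasDerivAt (fun r : ℝ => pair (fun x => u (x + r • h)) v)
      (pair (fun x => inner ℂ (toC h) (G x)) v) 0 := by
  rw [hasDerivAt_iff_isLittleO]
  have hline : Tendsto (fun r : ℝ => r • h) (𝓝 0) (𝓝 0) := by
    have : Continuous fun r : ℝ => r • h := by fun_prop
    simpa using this.tendsto 0
  have h1 := (isLittleO_l2norm_translate hu).comp_tendsto hline
  have h2 : (fun r : ℝ => r • h) =O[𝓝 0] (fun r : ℝ => r - 0) := by
    refine Asymptotics.IsBigO.of_bound ‖h‖ (.of_forall fun r => ?_)
    rw [norm_smul, sub_zero, mul_comm]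
  refine Asymptotics.IsBigO.trans_isLittleO ?_ (h1.trans_isBigO h2)
  refine Asymptotics.IsBigO.of_bound (l2norm v) (.of_forall fun r => ?_)
  have mu := memLp_translate hu.memLp (r • h)
  have mG := hu.memLp_grad.const_inner (𝕜 := ℂ) (toC (r • h))
  have e : pair (fun x => u (x + r • h)) v - pair (fun x => u (x + (0 : ℝ) • h)) v
        - (r - 0) • pair (fun x => inner ℂ (toC h) (G x)) v
      = pair (fun x => u (x + r • h) - u x - inner ℂ (toC (r • h)) (G x)) v := by
    have hs : MemLp (fun x => u (x + r • h) - u x) 2 volume := mu.sub hu.memLp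
    rw [pair_sub_left hs mG hv]
    have : pair (fun x => inner ℂ (toC (r • h)) (G x)) v
        = (r : ℂ) * pair (fun x => inner ℂ (toC h) (G x)) v := by
      rw [pair, pair, ← integral_const_mul]
      refine integral_congr_ae (.of_forall fun x => ?_)
      beta_reduce
      rw [map_smul, ← Complex.coe_smul, inner_smul_left]
      simp [mul_assoc]
    rw [this, pair_sub_left mu hu.memLp hv]
    simp
  rw [e, mul_comm]
  refine (norm_pair_le ((mu.sub hu.memLp).sub mG) hv).trans ?_
  refine mul_le_mul_of_nonneg_right ?_ (l2norm_nonneg v)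
  exact le_abs_self _

lemma pair_translate (u v : Space N → ℂ) (h : Space N) :
    pair (fun x => u (x + h)) v = pair u (fun x => v (x - h)) := by
  rw [pair, pair, ← integral_add_right_eq_self (fun x => u x * conj (v (x - h))) h]
  simp

/-- Integration by parts for two functions of `H¹`. -/
lemma pair_inner_grad_left {u v : Space N → ℂ} {G H : Space N → EuclideanSpace ℂ (Fin N)}
    (hu : HasGradL2 u G) (hv : HasGradL2 v H) (h : Space N) :
    pair (fun x => inner ℂ (toC h) (G x)) v = - pair u (fun x => inner ℂ (toC h) (H x)) := by
  have h1 := hasDerivAt_pair_translate hu hv.memLp h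
  have h2 := (hasDerivAt_pair_translate hv hu.memLp (-h)).star
  have h3 := h1.unique (h2.congr_of_eventuallyEq (.of_forall fun r => ?_))
  · rw [h3]
    have : pair (fun x => inner ℂ (toC (-h)) (H x)) u
        = - pair (fun x => inner ℂ (toC h) (H x)) u := by
      rw [pair, pair, ← integral_neg]
      simp
    rw [this, star_neg]
    exact congrArg Neg.neg (pair_conj_symm _ _)
  · beta_reduce
    rw [pair_translate]
    simp only [smul_neg, ← sub_eq_add_neg]
    exact (pair_conj_symm _ _).symm

/-! ### Differentiation of boosted functions with respect to the parameters -/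

/-- Dominated convergence in `L²`. -/
lemma tendsto_l2norm_zero_of_dominated {ι : Type*} {l : Filter ι} [l.IsCountablyGenerated]
    {m : ι → Space N → ℂ} {g : Space N → ℝ} (hg : MemLp g 2 volume)
    (hm : ∀ᶠ s in l, AEStronglyMeasurable (m s) volume)
    (hb : ∀ᶠ s in l, ∀ x, ‖m s x‖ ≤ g x) (hl : ∀ x, Tendsto (fun s => m s x) l (𝓝 0)) :
    Tendsto (fun s => l2norm (m s)) l (𝓝 0) := by
  have h1 : Tendsto (fun s => ∫ x, ‖m s x‖ ^ 2) l (𝓝 (∫ _ : Space N, (0 : ℝ))) := by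
    refine tendsto_integral_filter_of_dominated_convergence (fun x => g x ^ 2) ?_ ?_
      hg.integrable_sq (.of_forall fun x => ?_)
    · filter_upwards [hm] with s hs
      exact hs.norm.pow 2
    · filter_upwards [hb] with s hs
      refine .of_forall fun x => ?_
      rw [Real.norm_of_nonneg (by positivity)]
      exact pow_le_pow_left₀ (norm_nonneg _) (hs x) 2
    · simpa using ((hl x).norm.pow 2)
  have h2 : Tendsto (fun s => l2norm (m s) ^ 2) l (𝓝 0) := by
    rw [integral_zero] at h1
    refine h1.congr' ?_
    filter_upwards [hm, hb] with s h3 h4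
    refine (l2norm_sq (hg.mono h3 (.of_forall fun x => ?_))).symm
    exact (h4 x).trans (le_abs_self _)
  have h3 := h2.sqrt
  simpa [Real.sqrt_sq (l2norm_nonneg _)] using h3

lemma norm_exp_I_sub_exp_I_le (a b : ℝ) :
    ‖Complex.exp (Complex.I * a) - Complex.exp (Complex.I * b)‖ ≤ |a - b| := by
  have h : Complex.exp (Complex.I * a) - Complex.exp (Complex.I * b)
      = Complex.exp (Complex.I * b) * (Complex.exp (Complex.I * ((a - b : ℝ) : ℂ)) - 1) := by
    rw [mul_sub, ← Complex.exp_add]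
    congr 2 <;> push_cast <;> ring_nf
  rw [h, norm_mul, Complex.norm_exp_I_mul_ofReal, one_mul]
  exact Real.norm_exp_I_mul_ofReal_sub_one_le

/-- `u` translated by `c` and multiplied by the plane wave of phase `A + x·B`. -/
def wave (A : ℝ) (B c : Space N) (u : Space N → ℂ) (x : Space N) : ℂ :=
  Complex.exp (Complex.I * ((A + inner ℝ x B : ℝ) : ℂ)) * u (x + c)

lemma continuous_exp_phase (A : ℝ) (B : Space N) :
    Continuous fun x : Space N => Complex.exp (Complex.I * ((A + inner ℝ x B : ℝ) : ℂ)) := by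
  fun_prop

lemma memLp_exp_phase_mul {u : Space N → ℂ} (hu : MemLp u 2 volume) (A : ℝ) (B : Space N) :
    MemLp (fun x => Complex.exp (Complex.I * ((A + inner ℝ x B : ℝ) : ℂ)) * u x) 2 volume := by
  refine hu.congr_norm ((continuous_exp_phase A B).aestronglyMeasurable.mul hu.1)
    (.of_forall fun x => ?_)
  rw [norm_mul, Complex.norm_exp_I_mul_ofReal, one_mul]

/-- The derivative of `wave` along a curve with velocity `(A', B', c')`, at `c = 0`. -/
def waveDeriv (A : ℝ) (B : Space N) (A' : ℝ) (B' c' : Space N) (u : Space N → ℂ)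
    (G : Space N → EuclideanSpace ℂ (Fin N)) (x : Space N) : ℂ :=
  Complex.exp (Complex.I * ((A + inner ℝ x B : ℝ) : ℂ)) *
    (Complex.I * ((A' + inner ℝ x B' : ℝ) : ℂ) * u x + inner ℂ (toC c') (G x))

lemma memLp_linear_mul {u : Space N → ℂ} (hu : MemLp u 2 volume)
    (hxu : MemLp (fun x => ‖x‖ * ‖u x‖) 2 volume) (A : ℝ) (B : Space N) :
    MemLp (fun x => ((A + inner ℝ x B : ℝ) : ℂ) * u x) 2 volume := by
  refine ((hu.norm.const_mul |A|).add (hxu.const_mul ‖B‖)).mono ?_ (.of_forall fun x => ?_)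
  · have : Continuous fun x : Space N => ((A + inner ℝ x B : ℝ) : ℂ) := by fun_prop
    exact this.aestronglyMeasurable.mul hu.1
  · rw [norm_mul, Complex.norm_real]
    have h1 : ‖A + inner ℝ x B‖ ≤ |A| + ‖x‖ * ‖B‖ :=
      (norm_add_le _ _).trans (add_le_add le_rfl (norm_inner_le_norm _ _))
    refine (mul_le_mul_of_nonneg_right h1 (norm_nonneg _)).trans ?_
    refine le_trans (le_of_eq ?_) (le_abs_self _)
    simp only [Pi.add_apply]
    ring

/-- A boosted function of `H¹` of finite variance is differentiable in `L²` with respect to the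
phase, the wave vector and the translation. -/
lemma isLittleO_wave {u : Space N → ℂ} {G : Space N → EuclideanSpace ℂ (Fin N)}
    (hu : HasGradL2 u G) (hxu : MemLp (fun x => ‖x‖ * ‖u x‖) 2 volume)
    {A : ℝ → ℝ} {B c : ℝ → Space N} {A' : ℝ} {B' c' : Space N} {t : ℝ}
    (hA : HasDerivAt A A' t) (hB : HasDerivAt B B' t) (hc : HasDerivAt c c' t) (hct : c t = 0) :
    (fun s => l2norm (fun x => wave (A s) (B s) (c s) u x - wave (A t) (B t) (c t) u x
      - ((s - t : ℝ) : ℂ) * waveDeriv (A t) (B t) A' B' c' u G x)) =o[𝓝 t] (fun s => s - t) := by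
  set E : ℝ → Space N → ℂ :=
    fun s x => Complex.exp (Complex.I * ((A s + inner ℝ x (B s) : ℝ) : ℂ)) with hE
  have hEn : ∀ s x, ‖E s x‖ = 1 := fun s x => Complex.norm_exp_I_mul_ofReal _
  have hEc : ∀ s, Continuous (E s) := fun s => continuous_exp_phase _ _
  have hphase : ∀ x, HasDerivAt (fun s => A s + inner ℝ x (B s)) (A' + inner ℝ x B') t := by
    intro x
    have h1 := ((innerSL ℝ x).hasFDerivAt (x := B t)).comp_hasDerivAt t hB
    exact hA.add (by simpa [Function.comp_def] using h1)
  have hEd : ∀ x, HasDerivAt (fun s => E s x)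
      (E t x * (Complex.I * ((A' + inner ℝ x B' : ℝ) : ℂ))) t := fun x =>
    ((hphase x).ofReal_comp.const_mul Complex.I).cexp
  obtain ⟨K, hK0, hK⟩ : ∃ K : ℝ, 0 ≤ K ∧ ∀ᶠ s in 𝓝 t, ∀ x : Space N,
      ‖E s x - E t x‖ ≤ K * (1 + ‖x‖) * |s - t| := by
    obtain ⟨K1, h1⟩ := hA.isBigO_sub.bound
    obtain ⟨K2, h2⟩ := hB.isBigO_sub.bound
    refine ⟨|K1| + |K2|, by positivity, ?_⟩
    filter_upwards [h1, h2] with s h1 h2 x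
    refine (norm_exp_I_sub_exp_I_le _ _).trans ?_
    have e : A s + inner ℝ x (B s) - (A t + inner ℝ x (B t))
        = (A s - A t) + inner ℝ x (B s - B t) := by rw [inner_sub_right]; ring
    rw [e]
    rw [Real.norm_eq_abs, Real.norm_eq_abs] at h1
    rw [Real.norm_eq_abs] at h2
    have h3 : |inner ℝ x (B s - B t)| ≤ ‖x‖ * ‖B s - B t‖ := abs_real_inner_le_norm _ _
    have h4 : ‖x‖ * ‖B s - B t‖ ≤ ‖x‖ * (|K2| * |s - t|) :=
      mul_le_mul_of_nonneg_left
        (h2.trans (mul_le_mul_of_nonneg_right (le_abs_self _) (abs_nonneg _))) (norm_nonneg x)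
    have h5 : |A s - A t| ≤ |K1| * |s - t| :=
      h1.trans (mul_le_mul_of_nonneg_right (le_abs_self _) (abs_nonneg _))
    have h6 := abs_add_le (A s - A t) (inner ℝ x (B s - B t))
    have h7 : 0 ≤ |K2| * |s - t| := by positivity
    have h8 : 0 ≤ ‖x‖ * (|K1| * |s - t|) := by positivity
    nlinarith
  set w1 : ℝ → Space N → ℂ := fun s x => E s x * (u (x + c s) - u x - inner ℂ (toC (c s)) (G x))
  set w2 : ℝ → Space N → ℂ := fun s x => E s x * inner ℂ (toC (c s - (s - t) • c')) (G x)
  set w3 : ℝ → Space N → ℂ := fun s x => (E s x - E t x) * inner ℂ (toC c') (G x)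
  set w4 : ℝ → Space N → ℂ := fun s x =>
    (E s x - E t x - (s - t) • (E t x * (Complex.I * ((A' + inner ℝ x B' : ℝ) : ℂ)))) * u x
  have mG : ∀ h, MemLp (fun x => inner ℂ (toC h) (G x)) 2 volume := fun h =>
    hu.memLp_grad.const_inner (toC h)
  have m0 : ∀ s, MemLp (fun x => u (x + c s) - u x - inner ℂ (toC (c s)) (G x)) 2 volume :=
    fun s => ((memLp_translate hu.memLp (c s)).sub hu.memLp).sub (mG _)
  have m1 : ∀ s, MemLp (w1 s) 2 volume := fun s => memLp_exp_phase_mul (m0 s) _ _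
  have m2 : ∀ s, MemLp (w2 s) 2 volume := fun s => memLp_exp_phase_mul (mG _) _ _
  have m3 : ∀ s, MemLp (w3 s) 2 volume := fun s => by
    simp only [w3, sub_mul]
    exact (memLp_exp_phase_mul (mG _) _ _).sub (memLp_exp_phase_mul (mG _) _ _)
  have m4 : ∀ s, MemLp (w4 s) 2 volume := fun s => by
    have h1 : MemLp (fun x => E t x * (((A' + inner ℝ x B' : ℝ) : ℂ) * u x)) 2 volume :=
      memLp_exp_phase_mul (memLp_linear_mul hu.memLp hxu A' B') _ _
    have h2 : MemLp (fun x => E s x * u x - E t x * u x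
        - ((s - t : ℝ) : ℂ) * Complex.I * (E t x * (((A' + inner ℝ x B' : ℝ) : ℂ) * u x)))
        2 volume :=
      ((memLp_exp_phase_mul hu.memLp _ _).sub (memLp_exp_phase_mul hu.memLp _ _)).sub
        (h1.const_mul _)
    convert! h2 using 2 with x
    simp only [w4, Complex.real_smul]
    ring
  have hdecomp : ∀ s x, wave (A s) (B s) (c s) u x - wave (A t) (B t) (c t) u x
      - ((s - t : ℝ) : ℂ) * waveDeriv (A t) (B t) A' B' c' u G x
      = (w1 s x + w2 s x) + (((s - t : ℝ) : ℂ) * w3 s x + w4 s x) := by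
    intro s x
    simp only [wave, waveDeriv, w1, w2, w3, w4, hct, add_zero, Complex.real_smul]
    rw [map_sub, inner_sub_left, map_smul, ← Complex.coe_smul, inner_smul_left,
      Complex.conj_ofReal]
    simp only [hE]
    ring
  have hcO : c =O[𝓝 t] (fun s => s - t) := by
    simpa [hct] using hc.isBigO_sub
  have o1 : (fun s => l2norm (w1 s)) =o[𝓝 t] (fun s => s - t) := by
    have hc0 : Tendsto c (𝓝 t) (𝓝 0) := by simpa [hct] using hc.continuousAt.tendsto
    have h1 := ((isLittleO_l2norm_translate hu).comp_tendsto hc0).trans_isBigO hcO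
    refine h1.congr_left fun s => ?_
    exact l2norm_congr_ae (.of_forall fun x => by simp [w1, hEn])
  have o2 : (fun s => l2norm (w2 s)) =o[𝓝 t] (fun s => s - t) := by
    have h1 : (fun s => c s - (s - t) • c') =o[𝓝 t] (fun s => s - t) := by
      simpa [hct] using hasDerivAt_iff_isLittleO.1 hc
    refine (Asymptotics.IsBigO.of_bound (l2norm G) (.of_forall fun s => ?_)).trans_isLittleO h1
    rw [Real.norm_of_nonneg (l2norm_nonneg _), mul_comm]
    refine le_trans (le_of_eq ?_) (l2norm_inner_toC_le hu.memLp_grad _)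
    exact l2norm_congr_ae (.of_forall fun x => by simp [w2, hEn])
  have o3 : (fun s => l2norm (fun x => ((s - t : ℝ) : ℂ) * w3 s x)) =o[𝓝 t] (fun s => s - t) := by
    have h1 : Tendsto (fun s => l2norm (w3 s)) (𝓝 t) (𝓝 0) := by
      refine tendsto_l2norm_zero_of_dominated ((mG c').norm.const_mul 2)
        (.of_forall fun s => (m3 s).1) (.of_forall fun s x => ?_) fun x => ?_
      · simp only [w3, norm_mul]
        refine mul_le_mul_of_nonneg_right ?_ (norm_nonneg _)
        refine (norm_sub_le _ _).trans ?_
        rw [hEn, hEn]; norm_num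
      · have h2 : Tendsto (fun s => E s x - E t x) (𝓝 t) (𝓝 0) := by
          simpa using ((hEd x).continuousAt.tendsto.sub_const (E t x))
        simpa using h2.mul_const (inner ℂ (toC c') (G x))
    have h2 := (Asymptotics.isBigO_refl (fun s : ℝ => s - t) (𝓝 t)).mul_isLittleO
      ((Asymptotics.isLittleO_one_iff ℝ).2 h1)
    simp only [mul_one] at h2
    refine h2.norm_left.congr_left fun s => ?_
    have := l2norm_const_smul ((s - t : ℝ) : ℂ) (w3 s)
    simp only [smul_eq_mul] at this
    rw [this, norm_mul, Complex.norm_real, Real.norm_of_nonneg (l2norm_nonneg _)]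
  have o4 : (fun s => l2norm (w4 s)) =o[𝓝 t] (fun s => s - t) := by
    have h1 : Tendsto (fun s => l2norm (fun x => ((s - t)⁻¹ : ℝ) • w4 s x)) (𝓝 t) (𝓝 0) := by
      have hg : MemLp (fun x => (K + |A'|) * ‖u x‖ + (K + ‖B'‖) * (‖x‖ * ‖u x‖)) 2 volume :=
        (hu.memLp.norm.const_mul _).add (hxu.const_mul _)
      refine tendsto_l2norm_zero_of_dominated hg
        (.of_forall fun s => (m4 s).1.const_smul ((s - t)⁻¹ : ℝ)) ?_ fun x => ?_
      · filter_upwards [hK] with s hs x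
        rcases eq_or_ne s t with rfl | hst
        · simp; positivity
        have hpos : 0 < |s - t| := abs_pos.2 (sub_ne_zero.2 hst)
        have h2 : ‖A' + inner ℝ x B'‖ ≤ |A'| + ‖x‖ * ‖B'‖ :=
          (norm_add_le _ _).trans (add_le_add le_rfl (norm_inner_le_norm _ _))
        have h3 : ‖E s x - E t x - (s - t) • (E t x * (Complex.I * ((A' + inner ℝ x B' : ℝ) : ℂ)))‖
            ≤ (K * (1 + ‖x‖) + (|A'| + ‖x‖ * ‖B'‖)) * |s - t| := by
          refine (norm_sub_le _ _).trans ?_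
          rw [norm_smul, norm_mul, hEn, norm_mul, Complex.norm_I, Complex.norm_real, one_mul,
            one_mul, Real.norm_eq_abs, add_mul]
          refine add_le_add (hs x) ?_
          rw [mul_comm]
          exact mul_le_mul_of_nonneg_right h2 (abs_nonneg _)
        simp only [w4, norm_smul, norm_mul, norm_inv, Real.norm_eq_abs]
        rw [inv_mul_le_iff₀ hpos]
        refine (mul_le_mul_of_nonneg_right h3 (norm_nonneg _)).trans (le_of_eq ?_)
        ring
      · have h2 := hasDerivAt_iff_tendsto.1 (hEd x)
        rw [tendsto_zero_iff_norm_tendsto_zero]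
        have h3 := h2.mul_const ‖u x‖
        rw [zero_mul] at h3
        refine h3.congr fun s => ?_
        simp only [w4, norm_smul, norm_mul, norm_inv, mul_assoc]
    have h2 := (Asymptotics.isBigO_refl (fun s : ℝ => s - t) (𝓝 t)).mul_isLittleO
      ((Asymptotics.isLittleO_one_iff ℝ).2 h1)
    simp only [mul_one] at h2
    refine h2.norm_left.congr_left fun s => ?_
    rw [l2norm_const_smul, norm_mul, Real.norm_of_nonneg
      (mul_nonneg (norm_nonneg _) (l2norm_nonneg _)), ← mul_assoc, ← norm_mul]
    rcases eq_or_ne s t with rfl | hst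
    · have : w4 s = fun _ => 0 := by ext x; simp [w4]
      rw [this]; simp [l2norm]
    · rw [mul_inv_cancel₀ (sub_ne_zero.2 hst)]; simp
  simp only [hdecomp]
  refine Asymptotics.IsBigO.trans_isLittleO ?_ ((o1.add o2).add (o3.add o4))
  refine Asymptotics.IsBigO.of_bound 1 (.of_forall fun s => ?_)
  have m3' : MemLp (fun x => ((s - t : ℝ) : ℂ) * w3 s x) 2 volume := (m3 s).const_mul _
  rw [Real.norm_of_nonneg (l2norm_nonneg _), one_mul]
  refine le_trans ?_ (le_abs_self _)
  exact (l2norm_add_le ((m1 s).add (m2 s)) (m3'.add (m4 s))).trans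
    (add_le_add (l2norm_add_le (m1 s) (m2 s)) (l2norm_add_le m3' (m4 s)))

/-- The derivative of a pairing whose right factor is differentiable in `L²`, while the left one
is continuous in `L²` and differentiable against the value of the right one. -/
lemma hasDerivAt_pair {p Z : ℝ → Space N → ℂ} {D : Space N → ℂ} {t : ℝ} {d : ℂ}
    (hp : ∀ s, MemLp (p s) 2 volume) (hZ : ∀ s, MemLp (Z s) 2 volume) (hD : MemLp D 2 volume)
    (hpc : Tendsto (fun s => l2norm (fun x => p s x - p t x)) (𝓝 t) (𝓝 0))
    (hZd : (fun s => l2norm (fun x => Z s x - Z t x - ((s - t : ℝ) : ℂ) * D x))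
      =o[𝓝 t] (fun s => s - t))
    (hd : HasDerivAt (fun s => pair (p s) (Z t)) d t) :
    HasDerivAt (fun s => pair (p s) (Z s)) (d + pair (p t) D) t := by
  set P : ℝ → Lp ℂ 2 (volume : Measure (Space N)) := fun s => (hp s).toLp (p s) with hP
  set Y : ℝ → Lp ℂ 2 (volume : Measure (Space N)) := fun s => (hZ s).toLp (Z s) with hY
  have hPc : Tendsto P (𝓝 t) (𝓝 (P t)) := by
    rw [tendsto_iff_norm_sub_tendsto_zero]
    refine hpc.congr fun s => ?_
    rw [← MemLp.toLp_sub, ← l2norm_eq_norm_toLp]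
    rfl
  have hYd : HasDerivAt Y (hD.toLp D) t := by
    rw [hasDerivAt_iff_isLittleO]
    refine Asymptotics.IsLittleO.of_norm_left (hZd.congr_left fun s => ?_)
    rw [← MemLp.toLp_sub, ← MemLp.toLp_const_smul, ← MemLp.toLp_sub, ← l2norm_eq_norm_toLp]
    exact l2norm_congr_ae (.of_forall fun x => by simp)
  have h1 : HasDerivAt (fun s => inner ℂ (Y s - Y t) (P s)) (inner ℂ (hD.toLp D) (P t)) t := by
    rw [hasDerivAt_iff_tendsto_slope]
    have h2 := (hasDerivAt_iff_tendsto_slope.1 hYd).inner (𝕜 := ℂ)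
      (hPc.mono_left (nhdsWithin_le_nhds (s := {t}ᶜ)))
    refine h2.congr fun s => ?_
    rw [slope_def_module, slope_def_module, sub_self, inner_zero_left, sub_zero,
      inner_smul_left_eq_smul]
  have h2 : HasDerivAt (fun s => inner ℂ (Y t) (P s)) d t := by
    refine hd.congr_of_eventuallyEq (.of_forall fun s => ?_)
    exact (pair_eq_inner (hp s) (hZ t)).symm
  rw [pair_eq_inner (hp t) hD]
  refine (h2.add h1).congr_of_eventuallyEq (.of_forall fun s => ?_)
  simp only [Pi.add_apply]
  rw [pair_eq_inner (hp s) (hZ s), ← inner_add_left, add_sub_cancel]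

/-! ### Integrability against the potential -/

lemma integrableOn_ball_norm_rpow (hN : 3 ≤ N) {η δ : ℝ} (hη : η < N) (hδ : 0 < δ) :
    IntegrableOn (fun x : Space N => ‖x‖ ^ (-η)) (Metric.ball 0 δ) volume := by
  have : Nonempty (Fin N) := ⟨⟨0, by omega⟩⟩
  rw [integrableOn_fun_norm_addHaar volume (f := fun y : ℝ => y ^ (-η))]
  have h1 : IntegrableOn (fun y : ℝ => y ^ ((N : ℝ) - 1 - η)) (Set.Ioo 0 δ) volume :=
    (intervalIntegral.integrableOn_Ioo_rpow_iff hδ).2 (by linarith)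
  refine h1.congr_fun (fun y hy => ?_) measurableSet_Ioo
  have hN1 : ((N - 1 : ℕ) : ℝ) = (N : ℝ) - 1 := by rw [Nat.cast_sub (by omega)]; simp
  simp only [finrank_euclideanSpace, Fintype.card_fin, smul_eq_mul]
  rw [← Real.rpow_natCast, ← Real.rpow_add hy.1, hN1]
  congr 1

lemma aestronglyMeasurable_of_continuousOn_compl_zero (hN : 3 ≤ N) {g : Space N → F}
    (hg : ContinuousOn g {0}ᶜ) : AEStronglyMeasurable g volume := by
  have : Nonempty (Fin N) := ⟨⟨0, by omega⟩⟩
  have h := hg.aestronglyMeasurable (μ := volume) (measurableSet_singleton (0 : Space N)).compl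
  rwa [restrict_compl_singleton] at h

lemma exists_norm_le_of_memLp_top {w : Space N → F} (hw : MemLp w ⊤ volume) :
    ∃ M : ℝ, 0 ≤ M ∧ ∀ᵐ x, ‖w x‖ ≤ M := by
  refine ⟨(eLpNorm w ⊤ volume).toReal, ENNReal.toReal_nonneg, ?_⟩
  filter_upwards [ae_le_eLpNormEssSup (f := w) (μ := volume)] with x hx
  rw [← toReal_enorm]
  exact ENNReal.toReal_mono hw.eLpNorm_ne_top (by rwa [eLpNorm_exponent_top])

/-- Integrability of `w g` when `w` is integrable and bounded, and `g` has an integrable power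
singularity at the origin; the behaviour at infinity is a hypothesis. -/
lemma integrable_smul_of_singular [NormedSpace ℝ F] (hN : 3 ≤ N) {g : Space N → F}
    (hg : ContinuousOn g {0}ᶜ)
    {η : ℝ} (hη : η < N) (h0 : g =O[𝓝[≠] 0] fun x => ‖x‖ ^ (-η)) {w : Space N → ℝ}
    (hw : Integrable w volume) (hwb : MemLp w ⊤ volume) {R : ℝ}
    (hfar : IntegrableOn (fun x => w x • g x) {x | R ≤ ‖x‖} volume) :
    Integrable (fun x => w x • g x) volume := by
  have : Nonempty (Fin N) := ⟨⟨0, by omega⟩⟩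
  have hm : AEStronglyMeasurable (fun x => w x • g x) volume :=
    hw.1.smul (aestronglyMeasurable_of_continuousOn_compl_zero hN hg)
  obtain ⟨K, hK⟩ := h0.bound
  obtain ⟨δ, hδ, hb⟩ := Metric.eventually_nhds_iff.1 (eventually_nhdsWithin_iff.1 hK)
  obtain ⟨M, hM⟩ : ∃ M, ∀ x, δ ≤ ‖x‖ → ‖x‖ ≤ R → ‖g x‖ ≤ M := by
    have hc : IsCompact (Metric.closedBall (0 : Space N) R \ Metric.ball 0 δ) :=
      (isCompact_closedBall 0 R).diff Metric.isOpen_ball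
    have hsub : Metric.closedBall (0 : Space N) R \ Metric.ball 0 δ ⊆ {0}ᶜ := by
      rintro x hx rfl
      exact hx.2 (Metric.mem_ball_self hδ)
    obtain ⟨M, hM⟩ := hc.exists_bound_of_continuousOn (hg.mono hsub)
    exact ⟨M, fun x h1 h2 => hM x ⟨by simpa using h2, by simpa using h1⟩⟩
  obtain ⟨B, hB0, hB⟩ := exists_norm_le_of_memLp_top hwb
  have i1 : IntegrableOn (fun x => w x • g x) (Metric.ball 0 δ) volume := by
    refine ((integrableOn_ball_norm_rpow hN hη hδ).const_mul (B * K)).mono' hm.restrict ?_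
    have hne : ∀ᵐ x : Space N, x ≠ 0 := by simp [ae_iff]
    rw [ae_restrict_iff' measurableSet_ball]
    filter_upwards [hB, hne] with x hx hx0 hxδ
    have h1 := hb (by simpa using hxδ) hx0
    rw [Real.norm_of_nonneg (Real.rpow_nonneg (norm_nonneg _) _)] at h1
    rw [norm_smul, mul_assoc]
    exact mul_le_mul hx h1 (norm_nonneg _) hB0
  have i2 : IntegrableOn (fun x => w x • g x) {x | δ ≤ ‖x‖ ∧ ‖x‖ ≤ R} volume := by
    refine (hw.norm.integrableOn.const_mul M).mono' hm.restrict ?_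
    refine ae_restrict_of_forall_mem ?_ fun x hx => ?_
    · exact (measurableSet_le measurable_const measurable_norm).inter
        (measurableSet_le measurable_norm measurable_const)
    · rw [norm_smul, mul_comm]
      exact mul_le_mul_of_nonneg_right (hM x hx.1 hx.2) (norm_nonneg _)
  rw [← integrableOn_univ]
  refine ((i1.union i2).union hfar).mono_set fun x _ => ?_
  rcases lt_or_ge ‖x‖ δ with h | h
  · exact Or.inl (Or.inl (by simpa using h))
  · rcases le_total ‖x‖ R with h' | h'
    · exact Or.inl (Or.inr ⟨h, h'⟩)
    · exact Or.inr h'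

lemma norm_gradient (V : Space N → ℝ) (x : Space N) : ‖gradient V x‖ = ‖fderiv ℝ V x‖ := by
  simp [gradient]

lemma continuousOn_gradient {V : Space N → ℝ} {s : Set (Space N)} (hs : IsOpen s)
    (hV : ContDiffOn ℝ 2 V s) : ContinuousOn (gradient V) s :=
  (InnerProductSpace.toDual ℝ (Space N)).symm.continuous.comp_continuousOn
    (hV.continuousOn_fderiv_of_isOpen hs (by norm_num))

/-- A function with bounded second derivatives grows at most quadratically, and so does its
gradient. -/
lemma RegularPotential.exists_growth {V : Space N → ℝ} (hV : RegularPotential V) :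
    ∃ K : ℝ, 0 ≤ K ∧ ∀ x, |V x| ≤ K * (1 + ‖x‖ ^ 2) ∧ ‖gradient V x‖ ≤ K * (1 + ‖x‖ ^ 2) := by
  obtain ⟨h, hh⟩ := hV.second_deriv
  have hd1 : Differentiable ℝ V := hV.contDiff.differentiable (by norm_num)
  have hd2 : Differentiable ℝ (fderiv ℝ V) :=
    (hV.contDiff.fderiv_right (m := 1) (by norm_num)).differentiable (by norm_num)
  have h0 : 0 ≤ h := (norm_nonneg _).trans (hh 0)
  have hb : ∀ x, ‖fderiv ℝ (fderiv ℝ V) x‖ ≤ h := fun x => by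
    rw [← norm_iteratedFDeriv_one, norm_iteratedFDeriv_fderiv]
    exact hh x
  set D := ‖fderiv ℝ V 0‖ with hD
  have hD0 : 0 ≤ D := norm_nonneg _
  have hg : ∀ x, ‖fderiv ℝ V x‖ ≤ D + h * ‖x‖ := fun x => by
    have h1 := convex_univ.norm_image_sub_le_of_norm_fderiv_le (𝕜 := ℝ) (f := fderiv ℝ V)
      (fun x _ => hd2 x) (fun x _ => hb x) (Set.mem_univ 0) (Set.mem_univ x)
    rw [sub_zero] at h1
    have h2 := norm_le_norm_add_norm_sub' (fderiv ℝ V x) (fderiv ℝ V 0)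
    linarith
  have hv : ∀ x, |V x - V 0| ≤ (D + h * ‖x‖) * ‖x‖ := fun x => by
    have h1 := (convex_closedBall (0 : Space N) ‖x‖).norm_image_sub_le_of_norm_fderiv_le (𝕜 := ℝ)
      (f := V) (C := D + h * ‖x‖) (fun y _ => hd1 y) (fun y hy => (hg y).trans ?_)
      (Metric.mem_closedBall_self (norm_nonneg _)) (y := x) (by simp)
    · simpa using h1
    · have := mem_closedBall_zero_iff.1 hy
      nlinarith
  refine ⟨|V 0| + D + h, by positivity, fun x => ⟨?_, ?_⟩⟩
  · have h1 : |V x| ≤ |V 0| + (D + h * ‖x‖) * ‖x‖ := by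
      have := abs_sub_abs_le_abs_sub (V x) (V 0)
      linarith [hv x]
    nlinarith [sq_nonneg (‖x‖ - 1), norm_nonneg x, abs_nonneg (V 0), sq_nonneg ‖x‖]
  · rw [norm_gradient]
    refine (hg x).trans ?_
    nlinarith [sq_nonneg (‖x‖ - 1), norm_nonneg x, abs_nonneg (V 0), sq_nonneg ‖x‖]

lemma aestronglyMeasurable_potential (hN : 3 ≤ N) {V : Space N → ℝ}
    (hV : RegularPotential V ∨ SingularPotential V) :
    AEStronglyMeasurable V volume ∧ AEStronglyMeasurable (gradient V) volume := by
  rcases hV with hV | hV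
  · refine ⟨hV.contDiff.continuous.aestronglyMeasurable, ?_⟩
    have := continuousOn_gradient isOpen_univ hV.contDiff.contDiffOn
    exact (continuousOn_univ.1 this).aestronglyMeasurable
  · exact ⟨aestronglyMeasurable_of_continuousOn_compl_zero hN hV.contDiffOn.continuousOn,
      aestronglyMeasurable_of_continuousOn_compl_zero hN
        (continuousOn_gradient isOpen_compl_singleton hV.contDiffOn)⟩

/-- The potential and its gradient are integrable against a bounded integrable weight with finite
second moment. -/
lemma integrable_smul_potential (hN : 3 ≤ N) {V : Space N → ℝ}
    (hV : RegularPotential V ∨ SingularPotential V) {w : Space N → ℝ}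
    (hw : Integrable w volume) (hwb : MemLp w ⊤ volume)
    (hxw : Integrable (fun x => ‖x‖ ^ 2 * w x) volume) :
    Integrable (fun x => w x • V x) volume ∧ Integrable (fun x => w x • gradient V x) volume := by
  obtain ⟨m1, m2⟩ := aestronglyMeasurable_potential hN hV
  rcases hV with hV | hV
  · obtain ⟨K, hK, hb⟩ := hV.exists_growth
    have hi : Integrable (fun x => K * (‖w x‖ + ‖‖x‖ ^ 2 * w x‖)) volume :=
      (hw.norm.add hxw.norm).const_mul K
    have e : ∀ x : Space N, K * (‖w x‖ + ‖‖x‖ ^ 2 * w x‖) = ‖w x‖ * (K * (1 + ‖x‖ ^ 2)) := by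
      intro x
      rw [norm_mul, Real.norm_of_nonneg (sq_nonneg ‖x‖)]; ring
    constructor
    · refine hi.mono' (hw.1.smul m1) (.of_forall fun x => ?_)
      rw [e, norm_smul]
      exact mul_le_mul_of_nonneg_left (hb x).1 (norm_nonneg _)
    · refine hi.mono' (hw.1.smul m2) (.of_forall fun x => ?_)
      rw [e, norm_smul]
      exact mul_le_mul_of_nonneg_left (hb x).2 (norm_nonneg _)
  · obtain ⟨ζ, hζ0, hζ2, h1, h2⟩ := hV.near_zero
    have hN' : (3 : ℝ) ≤ N := by exact_mod_cast hN
    constructor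
    · refine integrable_smul_of_singular hN hV.contDiffOn.continuousOn (η := ζ) (by linarith)
        ?_ hw hwb (R := 1) ?_
      · exact h1.1.of_norm_left
      · obtain ⟨m, hm, hVm⟩ := hV.integrable_far
        have hm1 : 1 ≤ m := by linarith
        have hVi := hVm.integrable_norm_rpow (by simp; linarith) (by simp)
        rw [ENNReal.toReal_ofReal (by linarith)] at hVi
        obtain ⟨B, hB0, hB⟩ := exists_norm_le_of_memLp_top hwb
        -- `|V| ≤ 1 + |V|^m` reduces the claim to `w ∈ L¹ ∩ L^∞`
        have h3 : IntegrableOn (fun x => B * ‖V x‖ ^ m + ‖w x‖)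
          {x | 1 ≤ ‖x‖} volume := (hVi.const_mul _).add hw.norm.integrableOn
        refine h3.mono' (hw.1.smul m1).restrict ?_
        refine ae_restrict_of_ae ?_
        filter_upwards [hB] with x hx
        rw [norm_smul]
        have h4 : ‖V x‖ ≤ ‖V x‖ ^ m + 1 := by
          rcases le_total ‖V x‖ 1 with h | h
          · have := Real.rpow_nonneg (norm_nonneg (V x)) m
            linarith
          · have := Real.rpow_le_rpow_of_exponent_le h hm1
            rw [Real.rpow_one] at this
            linarith
        have h5 := Real.rpow_nonneg (norm_nonneg (V x)) m
        nlinarith [norm_nonneg (w x), norm_nonneg (V x)]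
    · have hc := continuousOn_gradient isOpen_compl_singleton hV.contDiffOn
      have hf := hV.grad_far.norm
      rw [norm_zero] at hf
      obtain ⟨R, hR⟩ : ∃ R : ℝ, ∀ x : Space N, R ≤ ‖x‖ → ‖gradient V x‖ ≤ 1 := by
        have := hf.eventually (gt_mem_nhds zero_lt_one)
        rw [← Metric.cobounded_eq_cocompact, ← comap_norm_atTop, eventually_comap] at this
        obtain ⟨R, hR⟩ := eventually_atTop.1 this
        exact ⟨R, fun x hx => (hR _ hx x rfl).le⟩
      refine integrable_smul_of_singular hN hc (η := ζ + 1) (by linarith)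
        (by simpa [neg_add, sub_eq_add_neg, add_comm] using h2) hw hwb (R := R) ?_
      refine hw.norm.integrableOn.mono' (hw.1.smul m2).restrict ?_
      refine ae_restrict_of_forall_mem (measurableSet_le measurable_const measurable_norm)
        fun x hx => ?_
      rw [norm_smul]
      exact mul_le_of_le_one_right (norm_nonneg _) (hR x hx)

/-! ### Pairings of boosted functions -/

lemma norm_boost (c : ℂ) (k b : Space N) (s : ℝ) (u : Space N → ℂ) (x : Space N) :
    ‖boost c k b s u x‖ = ‖c‖ * ‖u (b + s • x)‖ := by
  rw [boost, norm_mul, norm_mul, Complex.norm_exp_I_mul_ofReal, mul_one]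

/-- Multiplication by a function of the new variable commutes with the boost. -/
lemma pair_mul_boost (c : ℂ) (k b : Space N) (s : ℝ) (m : Space N → ℂ) (u v : Space N → ℂ) :
    pair (fun x => m (b + s • x) * boost c k b s u x) (boost c k b s v)
      = ((‖c‖ ^ 2 * (|s| ^ N)⁻¹ : ℝ) : ℂ) * pair (fun y => m y * u y) v := by
  have h := integral_comp_affine (fun y => m y * u y * conj (v y)) b s
  rw [pair, pair, Complex.ofReal_mul, mul_assoc, ← Complex.real_smul (x := (|s| ^ N)⁻¹), ← h,
    ← integral_const_mul]
  refine integral_congr_ae (.of_forall fun x => ?_)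
  have h1 : c * conj c = ((‖c‖ ^ 2 : ℝ) : ℂ) := by
    rw [Complex.mul_conj, Complex.normSq_eq_norm_sq]
  set e := Complex.exp (Complex.I * ((inner ℝ x k : ℝ) : ℂ)) with he
  have h2 : e * conj e = 1 := by
    rw [Complex.mul_conj, Complex.normSq_eq_norm_sq, he, Complex.norm_exp_I_mul_ofReal]; simp
  simp only [boost, map_mul, ← he]
  calc _ = (c * conj c) * (e * conj e) * (m (b + s • x) * u (b + s • x) * conj (v (b + s • x))) := by
        ring
    _ = _ := by rw [h1, h2, mul_one]

lemma pair_boost (c : ℂ) (k b : Space N) (s : ℝ) (u v : Space N → ℂ) :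
    pair (boost c k b s u) (boost c k b s v)
      = ((‖c‖ ^ 2 * (|s| ^ N)⁻¹ : ℝ) : ℂ) * pair u v := by
  simpa using pair_mul_boost c k b s (fun _ => 1) u v

lemma l2norm_boost_sq (c : ℂ) (k b : Space N) {s : ℝ} (hs : s ≠ 0) {u : Space N → ℂ}
    (hu : MemLp u 2 volume) :
    l2norm (boost c k b s u) ^ 2 = ‖c‖ ^ 2 * (|s| ^ N)⁻¹ * l2norm u ^ 2 := by
  have h := pair_boost c k b s u u
  rw [pair_self hu, pair_self (memLp_boost hu c k b hs)] at h
  exact_mod_cast h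

lemma gradPair_eq {u v : Space N → ℂ} {G H : Space N → EuclideanSpace ℂ (Fin N)}
    (hu : HasGradL2 u G) (hv : HasGradL2 v H) : gradPair u v = ∫ x, inner ℂ (H x) (G x) := by
  refine integral_congr_ae ?_
  filter_upwards [hu.weakGrad_ae_eq, hv.weakGrad_ae_eq] with x h1 h2
  rw [h1, h2]

lemma integrable_inner_grad {G H : Space N → EuclideanSpace ℂ (Fin N)}
    (hG : MemLp G 2 volume) (hH : MemLp H 2 volume) :
    Integrable (fun x => inner ℂ (H x) (G x)) volume := by
  refine (L2.integrable_inner (𝕜 := ℂ) (hH.toLp H) (hG.toLp G)).congr ?_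
  filter_upwards [hH.coeFn_toLp, hG.coeFn_toLp] with x h1 h2
  rw [h1, h2]

lemma gradPair_boost {u v : Space N → ℂ} {G H : Space N → EuclideanSpace ℂ (Fin N)}
    (hu : HasGradL2 u G) (hv : HasGradL2 v H) (c : ℂ) (k b : Space N) {s : ℝ} (hs : s ≠ 0) :
    gradPair (boost c k b s u) (boost c k b s v)
      = ((‖c‖ ^ 2 * (|s| ^ N)⁻¹ : ℝ) : ℂ) * ((s : ℂ) ^ 2 * gradPair u v
        + ((‖k‖ ^ 2 : ℝ) : ℂ) * pair u v
        + 2 * Complex.I * s * pair u (fun y => inner ℂ (toC k) (H y))) := by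
  have mH := hv.memLp_grad.const_inner (𝕜 := ℂ) (toC k)
  have mG := hu.memLp_grad.const_inner (𝕜 := ℂ) (toC k)
  have i1 := (integrable_inner_grad hu.memLp_grad hv.memLp_grad).const_mul ((s : ℂ) ^ 2)
  have i2 := (integrable_mul_conj hu.memLp hv.memLp).const_mul ((‖k‖ ^ 2 : ℝ) : ℂ)
  have i3 := (integrable_mul_conj hu.memLp mH).const_mul (Complex.I * s)
  have i4 := (integrable_mul_conj mG hv.memLp).const_mul (-(Complex.I * s))
  have hsum : (s : ℂ) ^ 2 * gradPair u v + ((‖k‖ ^ 2 : ℝ) : ℂ) * pair u v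
        + 2 * Complex.I * s * pair u (fun y => inner ℂ (toC k) (H y))
      = ∫ y, ((s : ℂ) ^ 2 * inner ℂ (H y) (G y) + ((‖k‖ ^ 2 : ℝ) : ℂ) * (u y * conj (v y))
          + (Complex.I * s * (u y * conj (inner ℂ (toC k) (H y)))
            + -(Complex.I * s) * (inner ℂ (toC k) (G y) * conj (v y)))) := by
    have i12 : Integrable (fun y => (s : ℂ) ^ 2 * inner ℂ (H y) (G y)
        + ((‖k‖ ^ 2 : ℝ) : ℂ) * (u y * conj (v y))) volume := i1.add i2
    have i34 : Integrable (fun y => Complex.I * s * (u y * conj (inner ℂ (toC k) (H y)))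
        + -(Complex.I * s) * (inner ℂ (toC k) (G y) * conj (v y))) volume := i3.add i4
    rw [integral_add i12 i34, integral_add i1 i2, integral_add i3 i4,
      integral_const_mul, integral_const_mul, integral_const_mul, integral_const_mul,
      gradPair_eq hu hv]
    have h := pair_inner_grad_left hu hv k
    simp only [pair] at h ⊢
    rw [h]
    ring
  rw [hsum, Complex.ofReal_mul, mul_assoc, ← Complex.real_smul (x := (|s| ^ N)⁻¹),
    ← integral_comp_affine _ b s, ← integral_const_mul,
    gradPair_eq (hu.boost c k b hs) (hv.boost c k b hs)]
  refine integral_congr_ae (.of_forall fun x => ?_)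
  have h1 : conj c * c = ((‖c‖ ^ 2 : ℝ) : ℂ) := by
    rw [mul_comm, Complex.mul_conj, Complex.normSq_eq_norm_sq]
  set e := Complex.exp (Complex.I * ((inner ℝ x k : ℝ) : ℂ)) with he
  have h2 : conj e * e = 1 := by
    rw [mul_comm, Complex.mul_conj, Complex.normSq_eq_norm_sq, he, Complex.norm_exp_I_mul_ofReal]; simp
  have h3 : ∀ z w : EuclideanSpace ℂ (Fin N),
      inner ℂ ((c * e) • z) ((c * e) • w) = ((‖c‖ ^ 2 : ℝ) : ℂ) * inner ℂ z w := by
    intro z w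
    rw [inner_smul_left, inner_smul_right, map_mul, ← h1]
    linear_combination (conj c * c * inner ℂ z w) * h2
  simp only [boostGrad, ← he, h3, inner_add_left, inner_add_right, inner_smul_left,
    inner_smul_right, inner_conj_symm, inner_toC_toC, real_inner_self_eq_norm_sq, map_mul,
    Complex.conj_I, Complex.conj_ofReal]
  linear_combination (-((‖c‖ ^ 2 : ℝ) : ℂ) * ((‖k‖ ^ 2 : ℝ) : ℂ) * u (b + s • x)
    * conj (v (b + s • x))) * Complex.I_sq

/-- A boost is undone by a boost. -/
lemma boost_boost_inv {c : ℂ} (hc : c ≠ 0) (k b : Space N) {s : ℝ} (hs : s ≠ 0)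
    (u : Space N → ℂ) :
    boost (c⁻¹ * Complex.exp (Complex.I * ((inner ℝ (s⁻¹ • b) k : ℝ) : ℂ))) (-(s⁻¹ • k))
      (-(s⁻¹ • b)) s⁻¹ (boost c k b s u) = u := by
  ext y
  have h1 : b + s • (-(s⁻¹ • b) + s⁻¹ • y) = y := by
    rw [smul_add, smul_neg, smul_smul, smul_smul, mul_inv_cancel₀ hs]; simp
  simp only [boost, h1]
  have h2 : Complex.exp (Complex.I * ((inner ℝ (s⁻¹ • b) k : ℝ) : ℂ))
      * Complex.exp (Complex.I * ((inner ℝ y (-(s⁻¹ • k)) : ℝ) : ℂ))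
      * Complex.exp (Complex.I * ((inner ℝ (-(s⁻¹ • b) + s⁻¹ • y) k : ℝ) : ℂ)) = 1 := by
    rw [← Complex.exp_add, ← Complex.exp_add, ← mul_add, ← mul_add, ← Complex.ofReal_add,
      ← Complex.ofReal_add]
    have : inner ℝ (s⁻¹ • b) k + inner ℝ y (-(s⁻¹ • k)) + inner ℝ (-(s⁻¹ • b) + s⁻¹ • y) k = 0 := by
      simp only [inner_add_left, inner_neg_left, inner_neg_right, real_inner_smul_left,
        real_inner_smul_right]
      ring
    rw [this]; simp
  linear_combination (c⁻¹ * c * u y) * h2 + u y * (inv_mul_cancel₀ hc)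

/-! ### Membership in the energy space -/

lemma memLp_norm_mul_boost {u : Space N → ℂ} (hu : MemLp u 2 volume)
    (hxu : MemLp (fun x => ‖x‖ * ‖u x‖) 2 volume) (c : ℂ) (k b : Space N) {s : ℝ} (hs : s ≠ 0) :
    MemLp (fun x => ‖x‖ * ‖boost c k b s u x‖) 2 volume := by
  have h1 : MemLp (fun y => ‖c‖ * |s|⁻¹ * (‖y‖ * ‖u y‖ + ‖b‖ * ‖u y‖)) 2 volume :=
    (hxu.add (hu.norm.const_mul ‖b‖)).const_mul _
  refine (memLp_comp_affine h1 b hs).mono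
    (continuous_norm.aestronglyMeasurable.mul (memLp_boost hu c k b hs).1.norm)
    (.of_forall fun x => ?_)
  rw [Real.norm_of_nonneg (by positivity), Real.norm_of_nonneg (by positivity), norm_boost]
  have h2 : ‖x‖ ≤ |s|⁻¹ * (‖b + s • x‖ + ‖b‖) := by
    have h3 : |s| * ‖x‖ ≤ ‖b + s • x‖ + ‖b‖ := by
      rw [← Real.norm_eq_abs, ← norm_smul]
      have := norm_sub_le (b + s • x) b
      simpa using this
    rwa [inv_mul_eq_div, le_div_iff₀' (abs_pos.2 hs)]
  calc ‖x‖ * (‖c‖ * ‖u (b + s • x)‖)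
      ≤ |s|⁻¹ * (‖b + s • x‖ + ‖b‖) * (‖c‖ * ‖u (b + s • x)‖) := by gcongr
    _ = _ := by ring

/-- The potential and its gradient are integrable against the density of a boosted bounded
function of finite variance. -/
lemma integrable_boost_density (hN : 3 ≤ N) {V : Space N → ℝ}
    (hV : RegularPotential V ∨ SingularPotential V) {u : Space N → ℂ} (hu : MemLp u 2 volume)
    (hut : MemLp u ⊤ volume) (hxu : MemLp (fun x => ‖x‖ * ‖u x‖) 2 volume)
    (c : ℂ) (k b : Space N) {s : ℝ} (hs : s ≠ 0) :
    Integrable (fun x => ‖boost c k b s u x‖ ^ 2 • V x) volume ∧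
      Integrable (fun x => ‖boost c k b s u x‖ ^ 2 • gradient V x) volume := by
  have mt := memLp_boost hut c k b hs
  refine integrable_smul_potential hN hV (memLp_boost hu c k b hs).norm.integrable_sq ?_ ?_
  · have := mt.norm.mul (p := ⊤) (q := ⊤) (r := ⊤) mt.norm
    simp only [sq]
    exact this
  · simpa only [mul_pow] using (memLp_norm_mul_boost hu hxu c k b hs).integrable_sq

lemma memEnergy_boost (hN : 3 ≤ N) {V : Space N → ℝ}
    (hV : RegularPotential V ∨ SingularPotential V) {u : Space N → ℂ} (hu : MemH1 u)
    (hut : MemLp u ⊤ volume) (hxu : MemLp (fun x => ‖x‖ * ‖u x‖) 2 volume)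
    (c : ℂ) (k b : Space N) {s : ℝ} (hs : s ≠ 0) : MemEnergy V (boost c k b s u) := by
  refine ⟨(hu.hasGradL2.boost c k b hs).memH1, ?_⟩
  have := (integrable_boost_density hN hV hu.1 hut hxu c k b hs).1.norm
  refine this.congr (.of_forall fun x => ?_)
  simp [mul_comm]

lemma MemH1.sub {u v : Space N → ℂ} (hu : MemH1 u) (hv : MemH1 v) :
    MemH1 (fun x => u x - v x) :=
  (hu.hasGradL2.sub hv.hasGradL2).memH1

lemma MemEnergy.sub {V : Space N → ℝ} (hVm : AEStronglyMeasurable V volume) {u v : Space N → ℂ}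
    (hu : MemEnergy V u) (hv : MemEnergy V v) : MemEnergy V (fun x => u x - v x) := by
  refine ⟨hu.1.sub hv.1, ?_⟩
  refine ((hu.2.add hv.2).const_mul 2).mono'
    (hVm.norm.mul ((hu.1.1.1.sub hv.1.1.1).norm.pow 2)) (.of_forall fun x => ?_)
  rw [Real.norm_of_nonneg (by positivity)]
  simp only [Pi.add_apply]
  have h1 : ‖u x - v x‖ ^ 2 ≤ 2 * (‖u x‖ ^ 2 + ‖v x‖ ^ 2) := by
    have := norm_sub_le (u x) (v x)
    nlinarith [norm_nonneg (u x - v x), sq_nonneg (‖u x‖ - ‖v x‖)]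
  nlinarith [abs_nonneg (V x)]

lemma MemEnergy.integrable_mul_conj {V : Space N → ℝ} (hVm : AEStronglyMeasurable V volume)
    {u v : Space N → ℂ} (hu : MemEnergy V u) (hv : MemEnergy V v) :
    Integrable (fun x => (V x : ℂ) * u x * conj (v x)) volume := by
  refine (hu.2.add hv.2).mono' (((Complex.continuous_ofReal.comp_aestronglyMeasurable hVm).mul
    hu.1.1.1).mul hv.1.1.1.star) (.of_forall fun x => ?_)
  rw [norm_mul, norm_mul, Complex.norm_real, RCLike.norm_conj, Real.norm_eq_abs]
  simp only [Pi.add_apply]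
  have : ‖u x‖ * ‖v x‖ ≤ ‖u x‖ ^ 2 + ‖v x‖ ^ 2 := by
    nlinarith [sq_nonneg (‖u x‖ - ‖v x‖), sq_nonneg ‖u x‖, sq_nonneg ‖v x‖]
  nlinarith [abs_nonneg (V x)]

lemma l2norm_le_energyNorm (V : Space N → ℝ) (u : Space N → ℂ) :
    l2norm u ≤ energyNorm V u := by
  refine Real.le_sqrt_of_sq_le ?_
  have : 0 ≤ ∫ x, |V x| * ‖u x‖ ^ 2 := integral_nonneg fun x => by positivity
  nlinarith [sq_nonneg (l2norm (weakGrad u))]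

lemma l2norm_sub_sq {u v : Space N → ℂ} (hu : MemLp u 2 volume) (hv : MemLp v 2 volume) :
    l2norm (fun x => u x - v x) ^ 2 = l2norm u ^ 2 - 2 * (pair u v).re + l2norm v ^ 2 := by
  have h := norm_sub_sq (𝕜 := ℂ) (hu.toLp u) (hv.toLp v)
  rw [← MemLp.toLp_sub, ← l2norm_eq_norm_toLp, ← l2norm_eq_norm_toLp, ← l2norm_eq_norm_toLp,
    ← inner_conj_symm, ← pair_eq_inner hu hv] at h
  simp only [RCLike.re_to_complex, Complex.conj_re] at h
  exact h

/-! ### Conservation of the charge -/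

lemma gradPair_conj_symm (u φ : Space N → ℂ) : conj (gradPair u φ) = gradPair φ u := by
  rw [gradPair, gradPair, ← integral_conj]
  simp only [inner_conj_symm]

lemma conj_pair_real_mul (m : Space N → ℝ) (u φ : Space N → ℂ) :
    conj (pair (fun x => (m x : ℂ) * u x) φ) = pair (fun x => (m x : ℂ) * φ x) u := by
  rw [pair, pair, ← integral_conj]
  refine integral_congr_ae (.of_forall fun x => ?_)
  simp only [map_mul, Complex.conj_ofReal, Complex.conj_conj]
  ring

lemma weakForm_self_im (ε α : ℝ) (f : Nonlinearity N) (V : Space N → ℝ) (u : Space N → ℂ) :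
    (weakForm ε α f V u u).im = 0 := by
  rw [← Complex.conj_eq_iff_im, weakForm, map_add, map_add, map_mul, gradPair_conj_symm,
    conj_pair_real_mul, map_pow, Complex.conj_ofReal]
  congr 1
  exact conj_pair_real_mul _ u u

lemma energyNorm_nonneg (V : Space N → ℝ) (u : Space N → ℂ) : 0 ≤ energyNorm V u :=
  Real.sqrt_nonneg _

section Solution

variable {ε α : ℝ} {f : Nonlinearity N} {V : Space N → ℝ} {ψ₀ : Space N → ℂ}
  {ψ : ℝ → Space N → ℂ}

lemma IsSolution.tendsto_l2norm_sub (hψ : IsSolution ε α f V ψ₀ ψ) (t : ℝ) :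
    Tendsto (fun s => l2norm (fun x => ψ s x - ψ t x)) (𝓝 t) (𝓝 0) :=
  squeeze_zero (fun _ => l2norm_nonneg _) (fun _ => l2norm_le_energyNorm V _) (hψ.continuous t)

lemma IsSolution.hasDerivAt_pair_const (hψ : IsSolution ε α f V ψ₀ ψ) (hε : 0 < ε)
    {φ : Space N → ℂ} (hφ : MemEnergy V φ) (t : ℝ) :
    HasDerivAt (fun s => pair (ψ s) φ) (-(Complex.I / ε) * weakForm ε α f V (ψ t) φ) t := by
  have hE := energyNorm_nonneg V φ
  have hε' : (ε : ℂ) ≠ 0 := by exact_mod_cast hε.ne'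
  rw [hasDerivAt_iff_isLittleO, Asymptotics.isLittleO_iff]
  intro δ hδ
  have hη : 0 < ε * δ / (energyNorm V φ + 1) := by positivity
  filter_upwards [hψ.equation t _ hη] with s hs
  have h := hs φ hφ
  have e : Complex.I * (ε : ℂ) * (pair (ψ s) φ - pair (ψ t) φ)
      - ((s - t : ℝ) : ℂ) * weakForm ε α f V (ψ t) φ
      = Complex.I * ε * (pair (ψ s) φ - pair (ψ t) φ
        - (s - t) • (-(Complex.I / ε) * weakForm ε α f V (ψ t) φ)) := by
    rw [Complex.real_smul]
    field_simp
    linear_combination (-((s - t : ℝ) : ℂ) * weakForm ε α f V (ψ t) φ) * Complex.I_sq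
  rw [e, norm_mul, norm_mul, Complex.norm_I, Complex.norm_real, one_mul,
    Real.norm_of_nonneg hε.le] at h
  rw [Real.norm_eq_abs]
  have h2 : ε * δ / (energyNorm V φ + 1) * |s - t| * energyNorm V φ ≤ ε * (δ * |s - t|) := by
    have : energyNorm V φ / (energyNorm V φ + 1) ≤ 1 := (div_le_one (by positivity)).2 (by linarith)
    calc _ = ε * (δ * |s - t|) * (energyNorm V φ / (energyNorm V φ + 1)) := by ring
      _ ≤ _ := mul_le_of_le_one_right (by positivity) this
  exact le_of_mul_le_mul_left (h.trans h2) hε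

/-- The equation makes the weak form bounded on the energy space, although nothing is assumed on
the growth of the nonlinearity. -/
lemma IsSolution.exists_weakForm_le (hψ : IsSolution ε α f V ψ₀ ψ) (hε : 0 < ε) (t : ℝ) :
    ∃ K : ℝ, 0 ≤ K ∧ ∀ φ, MemEnergy V φ →
      ‖weakForm ε α f V (ψ t) φ‖ ≤ K * energyNorm V φ := by
  have h1 := (hψ.equation t 1 one_pos).filter_mono (nhdsWithin_le_nhds (s := {t}ᶜ))
  obtain ⟨s, hs, hst⟩ := (h1.and self_mem_nhdsWithin).exists
  have hpos : 0 < |s - t| := abs_pos.2 (sub_ne_zero.2 hst)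
  set L := l2norm (fun x => ψ s x - ψ t x) with hL
  have hL0 : 0 ≤ L := l2norm_nonneg _
  refine ⟨ε * L / |s - t| + 1, by positivity, fun φ hφ => ?_⟩
  have h2 := hs φ hφ
  have h3 : ‖pair (ψ s) φ - pair (ψ t) φ‖ ≤ L * energyNorm V φ := by
    rw [← pair_sub_left (hψ.mem s).1.1 (hψ.mem t).1.1 hφ.1.1]
    refine (norm_pair_le ((hψ.mem s).1.1.sub (hψ.mem t).1.1) hφ.1.1).trans ?_
    exact mul_le_mul_of_nonneg_left (l2norm_le_energyNorm V φ) hL0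
  have h4 := norm_le_norm_add_norm_sub (Complex.I * (ε : ℂ) * (pair (ψ s) φ - pair (ψ t) φ))
    (((s - t : ℝ) : ℂ) * weakForm ε α f V (ψ t) φ)
  rw [norm_mul, norm_mul, norm_mul, Complex.norm_I, Complex.norm_real, Complex.norm_real, one_mul,
    Real.norm_of_nonneg hε.le, Real.norm_eq_abs] at h4
  have h5 := mul_le_mul_of_nonneg_left h3 hε.le
  refine le_of_mul_le_mul_left ?_ hpos
  calc |s - t| * ‖weakForm ε α f V (ψ t) φ‖
      ≤ ε * (L * energyNorm V φ) + 1 * |s - t| * energyNorm V φ := by linarith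
    _ = _ := by field_simp

/-- The charge is conserved: `‖ψ(s) - ψ(t)‖²` is of order `o(s - t)`, which follows from the
equation tested with `ψ(s) - ψ(t)` itself, and the weak form is real on the diagonal. -/
lemma IsSolution.hasDerivAt_charge (hψ : IsSolution ε α f V ψ₀ ψ) (hε : 0 < ε)
    (hVm : AEStronglyMeasurable V volume) (t : ℝ) :
    HasDerivAt (fun s => l2norm (ψ s) ^ 2) 0 t := by
  obtain ⟨K, hK0, hK⟩ := hψ.exists_weakForm_le hε t
  have hm : ∀ s, MemLp (ψ s) 2 volume := fun s => (hψ.mem s).1.1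
  have ho : (fun s => l2norm (fun x => ψ s x - ψ t x) ^ 2) =o[𝓝 t] (fun s => s - t) := by
    have h1 : (fun s => l2norm (fun x => ψ s x - ψ t x) ^ 2) =O[𝓝 t]
        (fun s => (s - t) * energyNorm V (fun x => ψ s x - ψ t x)) := by
      refine Asymptotics.IsBigO.of_bound (ε⁻¹ * (K + 1)) ?_
      filter_upwards [hψ.equation t 1 one_pos] with s hs
      have hφ := (hψ.mem s).sub hVm (hψ.mem t)
      have h2 := hs _ hφ
      have h3 := hK _ hφ
      have h4 := norm_le_norm_add_norm_sub' (Complex.I * (ε : ℂ)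
        * (pair (ψ s) (fun x => ψ s x - ψ t x) - pair (ψ t) (fun x => ψ s x - ψ t x)))
        (((s - t : ℝ) : ℂ) * weakForm ε α f V (ψ t) (fun x => ψ s x - ψ t x))
      rw [← pair_sub_left (hm s) (hm t) hφ.1.1] at h4 h2
      rw [pair_self hφ.1.1] at h4 h2
      rw [norm_mul, norm_mul, norm_mul, Complex.norm_I, Complex.norm_real, Complex.norm_real,
        Complex.norm_real, one_mul, Real.norm_of_nonneg hε.le, Real.norm_eq_abs (s - t)] at h4
      rw [norm_mul, Real.norm_eq_abs (s - t),
        Real.norm_of_nonneg (energyNorm_nonneg V _),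
        mul_assoc, le_inv_mul_iff₀ hε]
      have h5 := mul_le_mul_of_nonneg_left h3 (abs_nonneg (s - t))
      refine h4.trans ?_
      linarith
    refine h1.trans_isLittleO ?_
    have h2 := (Asymptotics.isBigO_refl (fun s : ℝ => s - t) (𝓝 t)).mul_isLittleO
      ((Asymptotics.isLittleO_one_iff ℝ).2 (hψ.continuous t))
    simpa using h2
  have h1 : HasDerivAt (fun s => l2norm (fun x => ψ s x - ψ t x) ^ 2) 0 t := by
    rw [hasDerivAt_iff_isLittleO]
    have h0 : l2norm (fun _ : Space N => (0 : ℂ)) = 0 := by simp [l2norm]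
    simpa [h0] using ho
  have h2 : HasDerivAt (fun s => (pair (ψ s) (ψ t)).re) 0 t := by
    have h3 := hψ.hasDerivAt_pair_const hε (hψ.mem t) t
    have h4 := (Complex.reCLM.hasFDerivAt (x := pair (ψ t) (ψ t))).comp_hasDerivAt t h3
    have h5 : Complex.reCLM (-(Complex.I / ε) * weakForm ε α f V (ψ t) (ψ t)) = 0 := by
      have := weakForm_self_im ε α f V (ψ t)
      simp [this, Complex.mul_re, Complex.div_ofReal_re]
    rw [h5] at h4
    exact h4
  have h6 := (h1.add (h2.const_mul 2)).sub_const (l2norm (ψ t) ^ 2)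
  simp only [mul_zero, add_zero] at h6
  refine h6.congr_of_eventuallyEq (.of_forall fun s => ?_)
  simp only [Pi.add_apply]
  rw [l2norm_sub_sq (hm s) (hm t)]
  ring

end Solution

/-! ### The moving frame -/

/-- The solitary wave in the gauge of the solution, `e^{-iω_ε/ε} U_σ`. -/
def gaugedSolitary (ε β γ : ℝ) (U : Space N → ℝ) (a ξ : Space N) (θ ωε : ℝ) (x : Space N) : ℂ :=
  Complex.exp (-(Complex.I / (ε : ℂ) * (ωε : ℂ))) * solitary ε β γ U a ξ θ x

/-- The phase of the gauged solitary wave at the origin of space. -/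
def framePhase (ε : ℝ) (a ξ : Space N) (θ ωε : ℝ) : ℝ :=
  (θ - ωε - 1 / 2 * inner ℝ a ξ) / ε

/-- The boost from the moving frame to the laboratory frame. -/
def frame (ε β γ : ℝ) (a ξ : Space N) (θ ωε : ℝ) (u : Space N → ℂ) : Space N → ℂ :=
  boost (((ε ^ γ : ℝ) : ℂ) * Complex.exp (Complex.I * (framePhase ε a ξ θ ωε : ℂ)))
    ((1 / (2 * ε)) • ξ) (-(ε ^ (-β) • a)) (ε ^ (-β)) u

section Frame

variable {ε α β γ : ℝ} {U : Space N → ℝ} {a ξ : Space N} {θ ωε : ℝ}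

lemma frame_arg (a x : Space N) (r : ℝ) : -(r • a) + r • x = r • (x - a) := by
  rw [smul_sub]; abel

lemma frame_coeff_ne_zero (hε : 0 < ε) :
    ((ε ^ γ : ℝ) : ℂ) * Complex.exp (Complex.I * (framePhase ε a ξ θ ωε : ℂ)) ≠ 0 :=
  mul_ne_zero (by exact_mod_cast (Real.rpow_pos_of_pos hε γ).ne') (Complex.exp_ne_zero _)

lemma norm_frame_coeff (hε : 0 < ε) :
    ‖((ε ^ γ : ℝ) : ℂ) * Complex.exp (Complex.I * (framePhase ε a ξ θ ωε : ℂ))‖ = ε ^ γ := by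
  rw [norm_mul, Complex.norm_exp_I_mul_ofReal, mul_one, Complex.norm_real,
    Real.norm_of_nonneg (Real.rpow_nonneg hε.le _)]

/-- The factor by which the frame multiplies the pairings. -/
lemma frame_factor (hε : 0 < ε) :
    ‖((ε ^ γ : ℝ) : ℂ) * Complex.exp (Complex.I * (framePhase ε a ξ θ ωε : ℂ))‖ ^ 2
      * (|ε ^ (-β)| ^ N)⁻¹ = ε ^ (2 * γ + β * N) := by
  rw [norm_frame_coeff hε, abs_of_pos (Real.rpow_pos_of_pos hε _), ← Real.rpow_natCast,
    ← Real.rpow_natCast, ← Real.rpow_mul hε.le, ← Real.rpow_mul hε.le, ← Real.rpow_neg hε.le,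
    ← Real.rpow_add hε]
  congr 1
  push_cast
  ring

lemma gaugedSolitary_eq_frame (hε : 0 < ε) :
    gaugedSolitary ε β γ U a ξ θ ωε = frame ε β γ a ξ θ ωε (fun y => (U y : ℂ)) := by
  have hε' : (ε : ℂ) ≠ 0 := by exact_mod_cast hε.ne'
  ext x
  have h1 : Complex.exp (-(Complex.I / (ε : ℂ) * (ωε : ℂ)))
        * Complex.exp (Complex.I / (ε : ℂ) * ((1 / 2 * inner ℝ (x - a) ξ + θ : ℝ) : ℂ))
      = Complex.exp (Complex.I * (framePhase ε a ξ θ ωε : ℂ))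
        * Complex.exp (Complex.I * ((inner ℝ x ((1 / (2 * ε)) • ξ) : ℝ) : ℂ)) := by
    rw [← Complex.exp_add, ← Complex.exp_add]
    congr 1
    rw [framePhase, inner_sub_left, real_inner_smul_right]
    push_cast
    field_simp
    ring
  simp only [gaugedSolitary, solitary, frame, boost, frame_arg, Complex.ofReal_mul]
  linear_combination (((ε ^ γ : ℝ) : ℂ) * (U (ε ^ (-β) • (x - a)) : ℂ)) * h1

/-- In the laboratory frame the error of the moving frame is the difference between the solution
and the gauged solitary wave. -/
lemma frame_errorTilde (hε : 0 < ε) (ψ : Space N → ℂ) :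
    frame ε β γ a ξ θ ωε (errorTilde ε β γ U a ξ θ ωε ψ)
      = fun x => ψ x - gaugedSolitary ε β γ U a ξ θ ωε x := by
  have hε' : (ε : ℂ) ≠ 0 := by exact_mod_cast hε.ne'
  ext x
  have h0 : ((ε ^ γ : ℝ) : ℂ) * ((ε ^ (-γ) : ℝ) : ℂ) = 1 := by
    rw [← Complex.ofReal_mul, ← Real.rpow_add hε]; simp
  have hb : ε ^ β * ε ^ (-β) = 1 := by rw [← Real.rpow_add hε]; simp
  have h1 : a + ε ^ β • ε ^ (-β) • (x - a) = x := by rw [smul_smul, hb]; simp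
  have h2 : Complex.exp (Complex.I * (framePhase ε a ξ θ ωε : ℂ))
        * Complex.exp (Complex.I * ((inner ℝ x ((1 / (2 * ε)) • ξ) : ℝ) : ℂ))
        * Complex.exp (-(Complex.I / (ε : ℂ))
          * ((1 / 2 * ε ^ β * inner ℝ (ε ^ (-β) • (x - a)) ξ + θ : ℝ) : ℂ))
      = Complex.exp (-(Complex.I / (ε : ℂ) * (ωε : ℂ))) := by
    have h3 : 1 / 2 * ε ^ β * inner ℝ (ε ^ (-β) • (x - a)) ξ
        = 1 / 2 * (inner ℝ x ξ - inner ℝ a ξ) := by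
      rw [real_inner_smul_left, inner_sub_left]
      linear_combination (1 / 2 * (inner ℝ x ξ - inner ℝ a ξ)) * hb
    rw [← Complex.exp_add, ← Complex.exp_add, h3]
    congr 1
    rw [framePhase, real_inner_smul_right]
    push_cast
    field_simp
    ring
  have h4 : Complex.exp (-(Complex.I / (ε : ℂ) * (ωε : ℂ)))
      * Complex.exp (Complex.I / (ε : ℂ) * (ωε : ℂ)) = 1 := by
    rw [← Complex.exp_add]; simp
  simp only [frame, boost, frame_arg, errorTilde, errorW, h1, gaugedSolitary]
  set S := solitary ε β γ U a ξ θ x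
  set e1 := Complex.exp (Complex.I * (framePhase ε a ξ θ ωε : ℂ))
  set e2 := Complex.exp (Complex.I * ((inner ℝ x ((1 / (2 * ε)) • ξ) : ℝ) : ℂ))
  set e3 := Complex.exp (-(Complex.I / (ε : ℂ))
          * ((1 / 2 * ε ^ β * inner ℝ (ε ^ (-β) • (x - a)) ξ + θ : ℝ) : ℂ))
  set e4 := Complex.exp (Complex.I / (ε : ℂ) * (ωε : ℂ))
  set e5 := Complex.exp (-(Complex.I / (ε : ℂ) * (ωε : ℂ)))
  linear_combination (e1 * e2 * e3 * (e4 * ψ x - S)) * h0 + (e4 * ψ x - S) * h2 + ψ x * h4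

lemma frame_add (u v : Space N → ℂ) (x : Space N) :
    frame ε β γ a ξ θ ωε (fun y => u y + v y) x
      = frame ε β γ a ξ θ ωε u x + frame ε β γ a ξ θ ωε v x := by
  simp only [frame, boost, mul_add]

lemma frame_add_errorTilde (hε : 0 < ε) (ψ : Space N → ℂ) :
    frame ε β γ a ξ θ ωε (fun y => (U y : ℂ) + errorTilde ε β γ U a ξ θ ωε ψ y) = ψ := by
  ext x
  rw [frame_add, frame_errorTilde hε, ← gaugedSolitary_eq_frame hε]
  ring

lemma memH1_of_frame (hε : 0 < ε) {u : Space N → ℂ} (h : MemH1 (frame ε β γ a ξ θ ωε u)) :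
    MemH1 u := by
  have hs : ε ^ (-β) ≠ 0 := (Real.rpow_pos_of_pos hε _).ne'
  rw [← boost_boost_inv (frame_coeff_ne_zero (γ := γ) (a := a) (ξ := ξ) (θ := θ) (ωε := ωε) hε)
    ((1 / (2 * ε)) • ξ) (-(ε ^ (-β) • a)) hs u]
  exact (h.hasGradL2.boost _ _ _ (inv_ne_zero hs)).memH1

lemma memH1_errorTilde (hε : 0 < ε) (hU : MemH1 (fun x => (U x : ℂ))) {ψ : Space N → ℂ}
    (hψ : MemH1 ψ) : MemH1 (errorTilde ε β γ U a ξ θ ωε ψ) := by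
  refine memH1_of_frame hε (β := β) (γ := γ) (a := a) (ξ := ξ) (θ := θ) (ωε := ωε) ?_
  rw [frame_errorTilde hε, gaugedSolitary_eq_frame hε]
  exact hψ.sub (hU.hasGradL2.boost _ _ _ (Real.rpow_pos_of_pos hε _).ne').memH1

lemma norm_errorW (ψ : Space N → ℂ) (x : Space N) :
    ‖errorW ε β γ U a ξ θ ωε ψ x‖ = ‖ψ x - gaugedSolitary ε β γ U a ξ θ ωε x‖ := by
  set e4 := Complex.exp (Complex.I / (ε : ℂ) * (ωε : ℂ)) with he4
  set e5 := Complex.exp (-(Complex.I / (ε : ℂ) * (ωε : ℂ))) with he5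
  have h4 : e4 * e5 = 1 := by rw [← Complex.exp_add]; simp
  have hn : ‖e4‖ = 1 := by
    rw [he4, show Complex.I / (ε : ℂ) * (ωε : ℂ) = Complex.I * ((ωε / ε : ℝ) : ℂ) by
      push_cast; ring, Complex.norm_exp_I_mul_ofReal]
  have : errorW ε β γ U a ξ θ ωε ψ x = e4 * (ψ x - gaugedSolitary ε β γ U a ξ θ ωε x) := by
    simp only [errorW, gaugedSolitary, ← he4, ← he5]
    linear_combination (solitary ε β γ U a ξ θ x) * h4
  rw [this, norm_mul, hn, one_mul]

/-- The relation between the norms of the error in the two frames. -/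
lemma l2norm_errorW (hε : 0 < ε) (hU : MemH1 (fun x => (U x : ℂ))) {ψ : Space N → ℂ}
    (hψ : MemH1 ψ) :
    l2norm (errorW ε β γ U a ξ θ ωε ψ)
      = ε ^ (γ + β * ((N : ℝ) / 2)) * l2norm (errorTilde ε β γ U a ξ θ ωε ψ) := by
  have h1 : l2norm (errorW ε β γ U a ξ θ ωε ψ)
      = l2norm (frame ε β γ a ξ θ ωε (errorTilde ε β γ U a ξ θ ωε ψ)) := by
    rw [frame_errorTilde hε]
    exact l2norm_congr_ae (.of_forall fun x => norm_errorW ψ x)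
  have hv := memH1_errorTilde (β := β) (γ := γ) (a := a) (ξ := ξ) (θ := θ) (ωε := ωε) hε hU hψ
  have hp : 0 ≤ ε ^ (γ + β * ((N : ℝ) / 2)) := Real.rpow_nonneg hε.le _
  rw [h1, ← sq_eq_sq₀ (l2norm_nonneg _) (mul_nonneg hp (l2norm_nonneg _)), frame,
    l2norm_boost_sq _ _ _ (Real.rpow_pos_of_pos hε _).ne' hv.1, frame_factor hε, mul_pow,
    ← Real.rpow_natCast (ε ^ _), ← Real.rpow_mul hε.le]
  congr 2
  push_cast
  ring

/-- The scaling of the nonlinear term. -/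
lemma nonlinTerm_frame (hε : 0 < ε) {f : Nonlinearity N}
    (hf : CommutesWithRescaling f (ε ^ (-β)))
    (hpar : (α = γ ∧ β = 1) ∨ ∃ p : ℝ, HomogeneousOfDegree f p ∧ β = 1 + (α - γ) * p)
    (u : Space N → ℂ) (x : Space N) :
    nonlinTerm ε α f (frame ε β γ a ξ θ ωε u) x
      = ((ε ^ (2 - 2 * β) * f (fun y => ‖u y‖ ^ 2) (-(ε ^ (-β) • a) + ε ^ (-β) • x) : ℝ) : ℂ)
        * frame ε β γ a ξ θ ωε u x := by
  rw [nonlinTerm]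
  congr 2
  have h1 : (fun y => ε ^ (-2 * α) * ‖frame ε β γ a ξ θ ωε u y‖ ^ 2)
      = fun y => ε ^ (2 * (γ - α)) * (fun z => ‖u (ε ^ (-β) • (z - a))‖ ^ 2) y := by
    ext y
    rw [frame, norm_boost, norm_frame_coeff hε, frame_arg, mul_pow, ← mul_assoc,
      ← Real.rpow_natCast (ε ^ γ), ← Real.rpow_mul hε.le, ← Real.rpow_add hε]
    congr 2
    push_cast
    ring
  have h2 := hf a (fun y => ‖u y‖ ^ 2) x
  rw [h1, frame_arg, ← h2]
  rcases hpar with ⟨rfl, rfl⟩ | ⟨p, hp, rfl⟩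
  · simp
  · rw [hp _ _ _ (Real.rpow_pos_of_pos hε _), ← Real.rpow_mul hε.le]
    congr 2
    ring

end Frame

/-! ### The derivative of the overlap of the solution with the solitary wave -/

lemma ProfileDecay.memLp_top {U : Space N → ℝ} (h : ProfileDecay U) :
    MemLp (fun x => (U x : ℂ)) ⊤ volume := h.bounded.ofReal

lemma ProfileDecay.memLp_norm_mul {U : Space N → ℝ} (h : ProfileDecay U) :
    MemLp (fun x => ‖x‖ * ‖(U x : ℂ)‖) 2 volume := by
  have := h.weighted_L2.norm
  simpa using this

lemma charge_pos {f : Nonlinearity N} {ω : ℝ} {U : Space N → ℝ} (hU : IsProfile f ω U) :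
    0 < charge U := by
  have h1 : MemLp U 2 volume := by simpa using hU.memH1.1.re
  refine (integral_pos_iff_support_of_nonneg (fun x => sq_nonneg (U x)) h1.integrable_sq).2 ?_
  have : Function.support (fun x => U x ^ 2) = Set.univ := by
    ext x
    simp [(hU.pos x).ne']
  rw [this]
  exact Measure.measure_univ_pos.2 (NeZero.ne _)

/-- The force on the center of the wave, split into the force of the potential at the center and
the gap due to the extension of the profile. -/
lemma force_eq (hN : 3 ≤ N) {ε β : ℝ} (hε : 0 < ε) {f : Nonlinearity N} {ω : ℝ} {U V : Space N → ℝ}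
    (hU : IsProfile f ω U) (hdecay : ProfileDecay U)
    (hV : RegularPotential V ∨ SingularPotential V) (a : Space N) :
    -(2 / charge U) • ∫ x, U x ^ 2 • gradient V (a + ε ^ β • x)
      = -((2 : ℝ) • (gradient V a + forceGap ε β U V a)) := by
  have hs : ε ^ β ≠ 0 := (Real.rpow_pos_of_pos hε β).ne'
  have hρ := (charge_pos hU).ne'
  have h1 : MemLp U 2 volume := by simpa using hU.memH1.1.re
  have h2 := (integrable_boost_density hN hV hU.memH1.1 hdecay.memLp_top hdecay.memLp_norm_mul
    1 0 (-((ε ^ β)⁻¹ • a)) (inv_ne_zero hs)).2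
  have h3 := integrable_comp_affine h2 a hs
  have h4 : Integrable (fun x => U x ^ 2 • gradient V (a + ε ^ β • x)) volume := by
    refine h3.congr (.of_forall fun x => ?_)
    beta_reduce
    rw [norm_boost, frame_arg, add_sub_cancel_left, smul_smul, inv_mul_cancel₀ hs]
    simp
  have h5 : Integrable (fun x => U x ^ 2 • gradient V a) volume :=
    h1.integrable_sq.smul_const _
  have h6 : forceGap ε β U V a = (1 / charge U) • (∫ x, U x ^ 2 • gradient V (a + ε ^ β • x))
      - gradient V a := by
    simp only [forceGap, smul_sub]
    rw [integral_sub h4 h5, integral_smul_const, smul_sub, ← charge, smul_smul,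
      one_div_mul_cancel hρ, one_smul]
  rw [h6, add_sub_cancel, smul_smul, ← neg_smul]
  congr 1
  ring

/-- The time derivative of the phase of the solitary wave at the point `a + ε^β y`, multiplied
by `ε`; here `ξ'` and `ω'` are the derivatives of `ξ` and of `ω_ε`. -/
def phaseRate (ε β ω' : ℝ) (ξ ξ' : Space N) (y : Space N) : ℝ :=
  -ω' - 1 / 2 * ‖ξ‖ ^ 2 + 1 / 2 * ε ^ β * inner ℝ y ξ'

/-- The time derivative of the gauged solitary wave, seen in the moving frame. -/
def frameVelocity (ε β ω' : ℝ) (U : Space N → ℝ) (ξ ξ' : Space N) (y : Space N) : ℂ :=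
  Complex.I / ε * (phaseRate ε β ω' ξ ξ' y : ℂ) * U y
    - ((ε ^ (-β) : ℝ) : ℂ) * inner ℂ (toC ξ) (weakGrad (fun x => (U x : ℂ)) y)

lemma phaseRate_eq (ε β ω' : ℝ) (ξ ξ' : Space N) (y : Space N) :
    phaseRate ε β ω' ξ ξ' y
      = (-ω' - 1 / 2 * ‖ξ‖ ^ 2) + inner ℝ y ((1 / 2 * ε ^ β) • ξ') := by
  rw [phaseRate, real_inner_smul_right]

lemma memLp_frameVelocity (ε β ω' : ℝ) {U : Space N → ℝ} (hU : MemH1 (fun x => (U x : ℂ)))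
    (hdecay : ProfileDecay U) (ξ ξ' : Space N) :
    MemLp (frameVelocity ε β ω' U ξ ξ') 2 volume := by
  have h1 := (memLp_linear_mul hU.1 hdecay.memLp_norm_mul (-ω' - 1 / 2 * ‖ξ‖ ^ 2)
    ((1 / 2 * ε ^ β) • ξ')).const_mul (Complex.I / ε)
  have h2 := (hU.hasGradL2.memLp_grad.const_inner (𝕜 := ℂ) (toC ξ)).const_mul
    ((ε ^ (-β) : ℝ) : ℂ)
  have h3 := h1.sub h2
  refine (memLp_congr_ae (.of_forall fun x => ?_)).1 h3
  simp only [frameVelocity, phaseRate_eq, Pi.sub_apply, mul_assoc]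

lemma wave_eq_gaugedSolitary {ε β γ : ℝ} (hε : 0 < ε) (U : Space N → ℝ) (a₀ a ξ : Space N)
    (θ ωε : ℝ) :
    wave (framePhase ε a ξ θ ωε) ((1 / (2 * ε)) • ξ) (a₀ - a)
        (boost ((ε ^ γ : ℝ) : ℂ) 0 (-(ε ^ (-β) • a₀)) (ε ^ (-β)) (fun y => (U y : ℂ)))
      = gaugedSolitary ε β γ U a ξ θ ωε := by
  rw [gaugedSolitary_eq_frame hε]
  ext x
  have h1 : x + (a₀ - a) - a₀ = x - a := by abel
  simp only [wave, frame, boost, frame_arg, h1, inner_zero_right, Complex.ofReal_zero, mul_zero,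
    Complex.exp_zero, mul_one, Complex.ofReal_add, mul_add, Complex.exp_add]
  ring

/-- The gauged solitary wave is differentiable in `L²` along a trajectory with velocity `ξ`. -/
lemma isLittleO_gaugedSolitary {ε β γ : ℝ} (hε : 0 < ε) {U : Space N → ℝ}
    (hU : MemH1 (fun x => (U x : ℂ))) (hdecay : ProfileDecay U) {a ξ : ℝ → Space N}
    {θ ωε : ℝ → ℝ} {t ω' : ℝ} {ξ' : Space N} (ha : HasDerivAt a (ξ t) t)
    (hξ : HasDerivAt ξ ξ' t) (hθ : HasDerivAt θ 0 t) (hω : HasDerivAt ωε ω' t) :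
    (fun s => l2norm (fun x => gaugedSolitary ε β γ U (a s) (ξ s) (θ s) (ωε s) x
        - gaugedSolitary ε β γ U (a t) (ξ t) (θ t) (ωε t) x
        - ((s - t : ℝ) : ℂ) * frame ε β γ (a t) (ξ t) (θ t) (ωε t)
          (frameVelocity ε β ω' U (ξ t) ξ') x)) =o[𝓝 t] (fun s => s - t) := by
  have hs : ε ^ (-β) ≠ 0 := (Real.rpow_pos_of_pos hε _).ne'
  have hb : ε ^ β * ε ^ (-β) = 1 := by rw [← Real.rpow_add hε]; simp
  have hε' : (ε : ℂ) ≠ 0 := by exact_mod_cast hε.ne'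
  have hinner : HasDerivAt (fun s => inner ℝ (a s) (ξ s)) (inner ℝ (a t) ξ' + inner ℝ (ξ t) (ξ t)) t :=
    ha.inner ℝ hξ
  have hA : HasDerivAt (fun s => framePhase ε (a s) (ξ s) (θ s) (ωε s))
      ((0 - ω' - 1 / 2 * (inner ℝ (a t) ξ' + inner ℝ (ξ t) (ξ t))) / ε) t :=
    ((hθ.sub hω).sub (hinner.const_mul (1 / 2))).div_const ε
  have hB : HasDerivAt (fun s => (1 / (2 * ε)) • ξ s) ((1 / (2 * ε)) • ξ') t :=
    hξ.const_smul (1 / (2 * ε))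
  have hc : HasDerivAt (fun s => a t - a s) (-(ξ t)) t := by
    simpa using ha.const_sub (a t)
  have h := isLittleO_wave
    (hU.hasGradL2.boost ((ε ^ γ : ℝ) : ℂ) 0 (-(ε ^ (-β) • a t)) hs)
    (memLp_norm_mul_boost hU.1 hdecay.memLp_norm_mul _ _ _ hs) hA hB hc (sub_self _)
  simp only [wave_eq_gaugedSolitary hε] at h
  refine h.congr_left fun s => l2norm_congr_ae (.of_forall fun x => ?_)
  congr 3
  have h2 : ((phaseRate ε β ω' (ξ t) ξ' (ε ^ (-β) • (x - a t)) : ℝ) : ℂ) / ε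
      = (((0 - ω' - 1 / 2 * (inner ℝ (a t) ξ' + inner ℝ (ξ t) (ξ t))) / ε
        + inner ℝ x ((1 / (2 * ε)) • ξ') : ℝ) : ℂ) := by
    rw [← Complex.ofReal_div]
    congr 1
    rw [phaseRate, real_inner_smul_left, real_inner_smul_right, inner_sub_left,
      real_inner_self_eq_norm_sq]
    field_simp
    linear_combination (inner ℝ x ξ' - inner ℝ (a t) ξ') * hb
  simp only [waveDeriv, ← h2]
  simp only [frame, boost, boostGrad, frameVelocity, frame_arg, inner_zero_right,
    Complex.ofReal_zero, mul_zero, Complex.exp_zero, mul_one, map_zero, smul_zero, add_zero,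
    map_neg, inner_neg_left, inner_smul_right, Complex.ofReal_add, mul_add, Complex.exp_add]
  ring

section Overlap

variable {ε α β γ ω : ℝ} {f : Nonlinearity N} {U V : Space N → ℝ}

/-- The integrand of the potential part in the equation for the error: the Taylor remainder of
the potential, corrected by the gap in the force. -/
def effectivePotential (ε β : ℝ) (U V : Space N → ℝ) (a y : Space N) : ℝ :=
  taylorRemainder ε β V a y - ε ^ β * inner ℝ y (forceGap ε β U V a)

/-- Integrability of a product is transferred from the laboratory frame to the moving frame. -/
lemma integrable_of_frame (hε : 0 < ε) {a ξ : Space N} {θ ωε : ℝ} {m u v : Space N → ℂ}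
    (h : Integrable (fun x => m x * frame ε β γ a ξ θ ωε u x * conj (frame ε β γ a ξ θ ωε v x))
      volume) :
    Integrable (fun y => m (a + ε ^ β • y) * u y * conj (v y)) volume := by
  have hs : ε ^ β ≠ 0 := (Real.rpow_pos_of_pos hε β).ne'
  have hb : ε ^ (-β) * ε ^ β = 1 := by rw [← Real.rpow_add hε]; simp
  have h1 := integrable_comp_affine h a hs
  have hg : (ε ^ γ) ≠ 0 := (Real.rpow_pos_of_pos hε γ).ne'
  have hg' : (((ε ^ γ) ^ 2 : ℝ) : ℂ) ≠ 0 := by exact_mod_cast pow_ne_zero 2 hg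
  refine (h1.const_mul (((ε ^ γ) ^ 2 : ℝ) : ℂ)⁻¹).congr (.of_forall fun y => ?_)
  simp only [frame, boost, frame_arg, add_sub_cancel_left, smul_smul, hb, one_smul]
  set c := ((ε ^ γ : ℝ) : ℂ) * Complex.exp (Complex.I * (framePhase ε a ξ θ ωε : ℂ)) with hc
  set e := Complex.exp (Complex.I * ((inner ℝ (a + ε ^ β • y) ((1 / (2 * ε)) • ξ) : ℝ) : ℂ)) with he
  have h2 : c * conj c = (((ε ^ γ) ^ 2 : ℝ) : ℂ) := by
    rw [Complex.mul_conj, Complex.normSq_eq_norm_sq, hc, norm_frame_coeff hε]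
  have h3 : e * conj e = 1 := by
    rw [Complex.mul_conj, Complex.normSq_eq_norm_sq, he, Complex.norm_exp_I_mul_ofReal]; simp
  rw [map_mul, map_mul, inv_mul_eq_iff_eq_mul₀ hg', ← h2]
  linear_combination (c * conj c * m (a + ε ^ β • y) * u y * conj (v y)) * h3

lemma effectivePotential_eq (hN : 3 ≤ N) (hε : 0 < ε) (hU : IsProfile f ω U)
    (hdecay : ProfileDecay U) (hV : RegularPotential V ∨ SingularPotential V) (a ξ y : Space N) :
    effectivePotential ε β U V a y = V (a + ε ^ β • y)
      + ((1 / 4 * ‖ξ‖ ^ 2 + ε ^ (2 - 2 * β) * ω)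
        + phaseRate ε β (ε ^ (2 - 2 * β) * ω - 1 / 4 * ‖ξ‖ ^ 2 + V a) ξ
          (-(2 / charge U) • ∫ x, U x ^ 2 • gradient V (a + ε ^ β • x)) y) := by
  rw [force_eq hN hε hU hdecay hV, effectivePotential, taylorRemainder, phaseRate, inner_neg_right,
    real_inner_smul_right, inner_add_right]
  ring

lemma integrable_effectivePotential (hN : 3 ≤ N) (hε : 0 < ε) (hU : IsProfile f ω U)
    (hdecay : ProfileDecay U) (hV : RegularPotential V ∨ SingularPotential V) {a ξ : Space N}
    {θ ωε : ℝ} {u : Space N → ℂ} (hu2 : MemLp u 2 volume)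
    (hu : MemEnergy V (frame ε β γ a ξ θ ωε u)) :
    Integrable (fun y => (effectivePotential ε β U V a y : ℂ) * u y * conj (U y : ℂ)) volume := by
  have hUE : MemEnergy V (frame ε β γ a ξ θ ωε (fun y => (U y : ℂ))) :=
    memEnergy_boost hN hV hU.memH1 hdecay.memLp_top hdecay.memLp_norm_mul _ _ _
      (Real.rpow_pos_of_pos hε _).ne'
  have hVm := (aestronglyMeasurable_potential hN hV).1
  have h1 := integrable_of_frame hε (hu.integrable_mul_conj hVm hUE)
  have h2 := integrable_mul_conj hu2 (memLp_linear_mul hU.memH1.1 hdecay.memLp_norm_mul (-V a)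
    (-(ε ^ β • (gradient V a + forceGap ε β U V a))))
  refine (h1.add h2).congr (.of_forall fun y => ?_)
  simp only [Pi.add_apply, map_mul, Complex.conj_ofReal, effectivePotential, taylorRemainder,
    inner_neg_right, real_inner_smul_right, inner_add_right]
  push_cast
  ring

/-- The derivative of the overlap, in the moving frame: the transport terms and the kinetic energy
of the center cancel. -/
lemma overlap_derivative_eq (hN : 3 ≤ N) (hε : 0 < ε)
    (hf : CommutesWithRescaling f (ε ^ (-β)))
    (hpar : (α = γ ∧ β = 1) ∨ ∃ p : ℝ, HomogeneousOfDegree f p ∧ β = 1 + (α - γ) * p)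
    (hU : IsProfile f ω U) (hdecay : ProfileDecay U)
    (hV : RegularPotential V ∨ SingularPotential V) {a ξ : Space N} {θ ωε : ℝ}
    {u : Space N → ℂ} (hu1 : MemH1 u) (hu : MemEnergy V (frame ε β γ a ξ θ ωε u)) :
    -(Complex.I / ε) * weakForm ε α f V (frame ε β γ a ξ θ ωε u)
        (gaugedSolitary ε β γ U a ξ θ ωε)
      + pair (frame ε β γ a ξ θ ωε u) (frame ε β γ a ξ θ ωε
        (frameVelocity ε β (ε ^ (2 - 2 * β) * ω - 1 / 4 * ‖ξ‖ ^ 2 + V a) U ξ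
          (-(2 / charge U) • ∫ x, U x ^ 2 • gradient V (a + ε ^ β • x))))
      = ((ε ^ (2 * γ + β * N) : ℝ) : ℂ) * (-(Complex.I / ε)) *
        (pair (fun y => (effectivePotential ε β U V a y : ℂ) * u y) (fun y => (U y : ℂ))
          + ((ε ^ (2 - 2 * β) : ℝ) : ℂ) * (gradPair u (fun y => (U y : ℂ))
            + pair (fun y => (f (fun z => ‖u z‖ ^ 2) y : ℂ) * u y) (fun y => (U y : ℂ))
            - ω * pair u (fun y => (U y : ℂ)))) := by
  have hε' : (ε : ℂ) ≠ 0 := by exact_mod_cast hε.ne'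
  have hs : ε ^ (-β) ≠ 0 := (Real.rpow_pos_of_pos hε _).ne'
  have hb : ε ^ β * ε ^ (-β) = 1 := by rw [← Real.rpow_add hε]; simp
  have hVm := (aestronglyMeasurable_potential hN hV).1
  set Uc : Space N → ℂ := fun y => (U y : ℂ) with hUc
  have hUE : MemEnergy V (frame ε β γ a ξ θ ωε Uc) :=
    memEnergy_boost hN hV hU.memH1 hdecay.memLp_top hdecay.memLp_norm_mul _ _ _ hs
  set κ : ℂ := ((ε ^ (2 * γ + β * N) : ℝ) : ℂ) with hκ
  set ω' := ε ^ (2 - 2 * β) * ω - 1 / 4 * ‖ξ‖ ^ 2 + V a with hω'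
  set ξ' := -(2 / charge U) • ∫ x, U x ^ 2 • gradient V (a + ε ^ β • x) with hξ'
  set P := pair u (fun y => inner ℂ (toC ξ) (weakGrad Uc y)) with hP
  have e1 : gradPair (frame ε β γ a ξ θ ωε u) (frame ε β γ a ξ θ ωε Uc)
      = κ * (((ε ^ (-β) : ℝ) : ℂ) ^ 2 * gradPair u Uc
        + ((1 / (4 * ε ^ 2) * ‖ξ‖ ^ 2 : ℝ) : ℂ) * pair u Uc
        + Complex.I / ε * ((ε ^ (-β) : ℝ) : ℂ) * P) := by
    rw [frame, frame, gradPair_boost hu1.hasGradL2 hU.memH1.hasGradL2 _ _ _ hs, frame_factor hε]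
    have h1 : pair u (fun y => inner ℂ (toC ((1 / (2 * ε)) • ξ)) (weakGrad Uc y))
        = ((1 / (2 * ε) : ℝ) : ℂ) * P := by
      rw [hP, pair, pair, ← integral_const_mul]
      refine integral_congr_ae (.of_forall fun x => ?_)
      beta_reduce
      rw [map_smul, ← Complex.coe_smul, inner_smul_left, Complex.conj_ofReal, map_mul,
        Complex.conj_ofReal]
      ring
    rw [h1, norm_smul, mul_pow, Real.norm_eq_abs, sq_abs]
    push_cast
    field_simp
    ring
  have e2 : pair (fun x => (V x : ℂ) * frame ε β γ a ξ θ ωε u x) (frame ε β γ a ξ θ ωε Uc)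
      = κ * pair (fun y => (V (a + ε ^ β • y) : ℂ) * u y) Uc := by
    have h1 := pair_mul_boost
      (((ε ^ γ : ℝ) : ℂ) * Complex.exp (Complex.I * (framePhase ε a ξ θ ωε : ℂ)))
      ((1 / (2 * ε)) • ξ) (-(ε ^ (-β) • a)) (ε ^ (-β)) (fun y => (V (a + ε ^ β • y) : ℂ)) u Uc
    rw [frame_factor hε] at h1
    simp only [frame_arg, smul_smul, hb, one_smul, add_sub_cancel] at h1
    exact h1
  have e3 : pair (nonlinTerm ε α f (frame ε β γ a ξ θ ωε u)) (frame ε β γ a ξ θ ωε Uc)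
      = κ * (((ε ^ (2 - 2 * β) : ℝ) : ℂ)
        * pair (fun y => (f (fun z => ‖u z‖ ^ 2) y : ℂ) * u y) Uc) := by
    have h1 := pair_mul_boost
      (((ε ^ γ : ℝ) : ℂ) * Complex.exp (Complex.I * (framePhase ε a ξ θ ωε : ℂ)))
      ((1 / (2 * ε)) • ξ) (-(ε ^ (-β) • a)) (ε ^ (-β))
      (fun y => ((ε ^ (2 - 2 * β) * f (fun z => ‖u z‖ ^ 2) y : ℝ) : ℂ)) u Uc
    rw [frame_factor hε] at h1
    have h2 : nonlinTerm ε α f (frame ε β γ a ξ θ ωε u) = fun x => _ :=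
      funext fun x => nonlinTerm_frame hε hf hpar u x
    rw [h2]
    refine h1.trans ?_
    congr 1
    rw [pair, pair, ← integral_const_mul]
    refine integral_congr_ae (.of_forall fun x => ?_)
    push_cast
    ring
  have i1 := integrable_of_frame hε (hu.integrable_mul_conj hVm hUE)
  have mμ := memLp_linear_mul hU.memH1.1 hdecay.memLp_norm_mul (-ω' - 1 / 2 * ‖ξ‖ ^ 2)
    ((1 / 2 * ε ^ β) • ξ')
  simp only [← phaseRate_eq] at mμ
  have i2 := integrable_mul_conj hu1.1 mμ
  have i3 := integrable_mul_conj hu1.1 hU.memH1.1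
  set M := pair u (fun y => (phaseRate ε β ω' ξ ξ' y : ℂ) * Uc y) with hM
  have e4 : pair (frame ε β γ a ξ θ ωε u)
      (frame ε β γ a ξ θ ωε (frameVelocity ε β ω' U ξ ξ'))
      = κ * (-(Complex.I / ε) * M - ((ε ^ (-β) : ℝ) : ℂ) * P) := by
    rw [frame, frame, pair_boost, frame_factor hε]
    have i4 := integrable_mul_conj hu1.1
      (hU.memH1.hasGradL2.memLp_grad.const_inner (𝕜 := ℂ) (toC ξ))
    congr 1
    rw [hM, hP, pair, pair, pair, ← integral_const_mul, ← integral_const_mul,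
      ← integral_sub (i2.const_mul _) (i4.const_mul _)]
    refine integral_congr_ae (.of_forall fun x => ?_)
    simp only [frameVelocity, map_sub, map_mul, map_div₀, Complex.conj_I, Complex.conj_ofReal]
    ring
  have e5 : pair (fun y => (effectivePotential ε β U V a y : ℂ) * u y) Uc
      = pair (fun y => (V (a + ε ^ β • y) : ℂ) * u y) Uc
        + (((1 / 4 * ‖ξ‖ ^ 2 + ε ^ (2 - 2 * β) * ω : ℝ) : ℂ) * pair u Uc + M) := by
    rw [hM, pair, pair, pair, pair, ← integral_const_mul,
      ← integral_add (i3.const_mul _) i2]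
    have i5 : Integrable (fun y => ((1 / 4 * ‖ξ‖ ^ 2 + ε ^ (2 - 2 * β) * ω : ℝ) : ℂ)
        * (u y * conj (Uc y)) + u y * conj ((phaseRate ε β ω' ξ ξ' y : ℂ) * Uc y)) volume :=
      (i3.const_mul _).add i2
    rw [← integral_add i1 i5]
    refine integral_congr_ae (.of_forall fun y => ?_)
    simp only [effectivePotential_eq hN hε hU hdecay hV a ξ y, map_mul, Complex.conj_ofReal]
    push_cast
    ring
  rw [gaugedSolitary_eq_frame hε, weakForm, e1, e2, e3, e4, e5]
  have hβ : ((ε ^ (2 - 2 * β) : ℝ) : ℂ) = (ε : ℂ) ^ 2 * ((ε ^ (-β) : ℝ) : ℂ) ^ 2 := by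
    rw [← Complex.ofReal_pow, ← Complex.ofReal_pow, ← Complex.ofReal_mul]
    congr 1
    rw [← Real.rpow_natCast (ε ^ (-β)), ← Real.rpow_mul hε.le, ← Real.rpow_natCast ε,
      ← Real.rpow_add hε]
    congr 1
    push_cast
    ring
  push_cast [hβ]
  field_simp
  linear_combination (-κ * 4 * ((ε ^ (-β) : ℝ) : ℂ) * ε * P) * Complex.I_sq

end Overlap

/-! ### Estimate of the derivative of the error -/

lemma lintegral_enorm_mul_le {g : Space N → ℝ} {v : Space N → ℂ}
    (hg : AEStronglyMeasurable g volume) (hv : AEStronglyMeasurable v volume) :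
    ∫⁻ x, ‖g x‖ₑ * ‖v x‖ₑ ≤ eLpNorm g 2 volume * eLpNorm v 2 volume := by
  have h := eLpNorm_smul_le_mul_eLpNorm (p := 2) (q := 2) (r := 1) hv hg
  rw [eLpNorm_one_eq_lintegral_enorm] at h
  simpa only [Pi.smul_apply', enorm_smul] using h

lemma eLpNorm_eq_ofReal_l2norm {u : Space N → F} (hu : MemLp u 2 volume) :
    eLpNorm u 2 volume = ENNReal.ofReal (l2norm u) :=
  (ENNReal.ofReal_toReal hu.eLpNorm_ne_top).symm

section Estimates

variable {ε α β γ ω : ℝ} {f : Nonlinearity N} {U V : Space N → ℝ}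

/-- The potential part: only the imaginary part of the error contributes. -/
lemma ofReal_abs_im_effectivePotential_le (hε : 0 < ε) (hVm : AEStronglyMeasurable V volume)
    (hU : MemH1 (fun x => (U x : ℂ))) {a : Space N} {v : Space N → ℂ} (hv : MemLp v 2 volume)
    (hint : Integrable (fun y => (effectivePotential ε β U V a y : ℂ) * ((U y : ℂ) + v y)
      * conj (U y : ℂ)) volume) :
    ENNReal.ofReal |(pair (fun y => (effectivePotential ε β U V a y : ℂ) * ((U y : ℂ) + v y))
        (fun y => (U y : ℂ))).im|
      ≤ (eLpNorm (fun x => |taylorRemainder ε β V a x| * U x) 2 volume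
          + ENNReal.ofReal (ε ^ β * ‖forceGap ε β U V a‖)
            * eLpNorm (fun x : Space N => ‖x‖ * U x) 2 volume) * ENNReal.ofReal (l2norm v) := by
  have hs : ε ^ β ≠ 0 := (Real.rpow_pos_of_pos hε β).ne'
  have hUm : AEStronglyMeasurable U volume := by
    have h1 : MemLp U 2 volume := by simpa using hU.1.re
    exact h1.1
  have hRm : AEStronglyMeasurable (fun x => |taylorRemainder ε β V a x| * U x) volume := by
    have h1 := hVm.comp_quasiMeasurePreserving (quasiMeasurePreserving_affine a hs)
    have h2 : Continuous fun x : Space N => ε ^ β * inner ℝ x (gradient V a) := by fun_prop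
    exact ((h1.sub aestronglyMeasurable_const).sub h2.aestronglyMeasurable).norm.mul hUm
  have hxm : AEStronglyMeasurable (fun x : Space N => ‖x‖ * U x) volume :=
    continuous_norm.aestronglyMeasurable.mul hUm
  have him : (pair (fun y => (effectivePotential ε β U V a y : ℂ) * ((U y : ℂ) + v y))
      (fun y => (U y : ℂ))).im = ∫ y, effectivePotential ε β U V a y * (v y).im * U y := by
    have h1 := integral_im hint
    rw [pair]
    refine h1.symm.trans (integral_congr_ae (.of_forall fun y => ?_))
    simp
  rw [him, ← Real.norm_eq_abs, ofReal_norm]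
  refine (enorm_integral_le_lintegral_enorm _).trans ?_
  have hb : ∀ y, ‖effectivePotential ε β U V a y * (v y).im * U y‖ₑ
      ≤ ‖|taylorRemainder ε β V a y| * U y‖ₑ * ‖v y‖ₑ
        + ENNReal.ofReal (ε ^ β * ‖forceGap ε β U V a‖) * (‖‖y‖ * U y‖ₑ * ‖v y‖ₑ) := by
    intro y
    have h0 : 0 ≤ ε ^ β * ‖forceGap ε β U V a‖ :=
      mul_nonneg (Real.rpow_nonneg hε.le _) (norm_nonneg _)
    simp only [← ofReal_norm]
    rw [← ENNReal.ofReal_mul (norm_nonneg _), ← ENNReal.ofReal_mul (norm_nonneg _),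
      ← ENNReal.ofReal_mul h0, ← ENNReal.ofReal_add (by positivity) (by positivity)]
    refine ENNReal.ofReal_le_ofReal ?_
    have h1 : |effectivePotential ε β U V a y|
        ≤ |taylorRemainder ε β V a y| + ε ^ β * ‖forceGap ε β U V a‖ * ‖y‖ := by
      refine (abs_sub _ _).trans (add_le_add le_rfl ?_)
      rw [abs_mul, abs_of_pos (Real.rpow_pos_of_pos hε β), mul_assoc]
      refine mul_le_mul_of_nonneg_left ?_ (Real.rpow_nonneg hε.le _)
      rw [mul_comm]
      exact abs_real_inner_le_norm _ _
    simp only [norm_mul, Real.norm_eq_abs, abs_abs, abs_norm]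
    have h2 : |(v y).im| ≤ ‖v y‖ := Complex.abs_im_le_norm _
    calc |effectivePotential ε β U V a y| * |(v y).im| * |U y|
        ≤ (|taylorRemainder ε β V a y| + ε ^ β * ‖forceGap ε β U V a‖ * ‖y‖) * ‖v y‖ * |U y| := by
          gcongr
      _ = _ := by ring
  refine (lintegral_mono hb).trans ?_
  have hRv : AEMeasurable (fun y => ‖|taylorRemainder ε β V a y| * U y‖ₑ * ‖v y‖ₑ) volume :=
    hRm.enorm.mul hv.1.enorm
  rw [lintegral_add_left' hRv,
    lintegral_const_mul' _ _ ENNReal.ofReal_ne_top, add_mul, mul_assoc,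
    ← eLpNorm_eq_ofReal_l2norm hv]
  gcongr
  · exact lintegral_enorm_mul_le hRm hv.1
  · exact lintegral_enorm_mul_le hxm hv.1

/-- The nonlinear part: the equation of the profile, tested with `U + v`, turns it into the
pairing of the remainder of the nonlinearity with `iU`. -/
lemma abs_im_nonlinear_le (hU : IsProfile f ω U) {C : ℝ}
    (hC : IsRemainderConst f U (fun x => Complex.I * (U x : ℂ)) C) {v : Space N → ℂ}
    (hv : MemH1 v) (hv1 : l2norm v ≤ 1) (hu : MemH1 (fun y => (U y : ℂ) + v y))
    (hint : Integrable (fun y => (f (fun z => ‖(U z : ℂ) + v z‖ ^ 2) y : ℂ) * ((U y : ℂ) + v y)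
      * conj (U y : ℂ)) volume) :
    |(gradPair (fun y => (U y : ℂ) + v y) (fun y => (U y : ℂ))
      + pair (fun y => (f (fun z => ‖(U z : ℂ) + v z‖ ^ 2) y : ℂ) * ((U y : ℂ) + v y))
          (fun y => (U y : ℂ))
      - ω * pair (fun y => (U y : ℂ) + v y) (fun y => (U y : ℂ))).im| ≤ C * l2norm v := by
  obtain ⟨h1, h2⟩ := hC.2 v hv hv1
  have h3 := congrArg conj (hU.equation _ hu)
  rw [map_zero, map_sub, map_add, map_mul, gradPair_conj_symm, pair_conj_symm, pair_conj_symm,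
    Complex.conj_ofReal] at h3
  have i2 : Integrable (fun y => ((U y : ℂ) + v y)
      * conj ((f (fun z => U z ^ 2) y * U y : ℝ) : ℂ)) volume := by
    have h := Complex.conjLIE.toContinuousLinearEquiv.toContinuousLinearMap.integrable_comp
      (hU.integrable _ hu)
    refine h.congr (.of_forall fun y => ?_)
    simp [mul_comm]
  have e : gradPair (fun y => (U y : ℂ) + v y) (fun y => (U y : ℂ))
      + pair (fun y => (f (fun z => ‖(U z : ℂ) + v z‖ ^ 2) y : ℂ) * ((U y : ℂ) + v y))
          (fun y => (U y : ℂ))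
      - ω * pair (fun y => (U y : ℂ) + v y) (fun y => (U y : ℂ))
      = ∫ y, ((f (fun z => ‖(U z : ℂ) + v z‖ ^ 2) y : ℂ) * ((U y : ℂ) + v y) * conj (U y : ℂ)
        - ((U y : ℂ) + v y) * conj ((f (fun z => U z ^ 2) y * U y : ℝ) : ℂ)) := by
    rw [integral_sub hint i2]
    simp only [pair] at h3 ⊢
    linear_combination h3
  have him : (∫ y, ((f (fun z => ‖(U z : ℂ) + v z‖ ^ 2) y : ℂ) * ((U y : ℂ) + v y)
        * conj (U y : ℂ) - ((U y : ℂ) + v y) * conj ((f (fun z => U z ^ 2) y * U y : ℝ) : ℂ))).im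
      = (∫ x, nonlinRemainder f U v x * conj (Complex.I * (U x : ℂ))).re := by
    have h4 := integral_im (hint.sub i2)
    have h5 := integral_re h1
    refine h4.symm.trans ((integral_congr_ae (.of_forall fun y => ?_)).trans h5)
    simp [nonlinRemainder]
    ring
  rw [e, him]
  exact (Complex.abs_re_le_norm _).trans h2

end Estimates

/-- The final inequality, from the bounds of the potential part `I₁` and the nonlinear part `I₂`;
`X` and `Y` may be infinite. -/
lemma ofReal_derivative_le {ε β γ n κ L W C b I₁ I₂ : ℝ} {X Y : ℝ≥0∞} (hε : 0 < ε) (hL : 0 ≤ L)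
    (hb : 0 ≤ b) (hκ : κ = ε ^ (2 * γ + β * n))
    (hW : W = ε ^ (γ + β * (n / 2)) * L)
    (h1 : ENNReal.ofReal |I₁| ≤ (X + ENNReal.ofReal (ε ^ β * b) * Y) * ENNReal.ofReal L)
    (h2 : |I₂| ≤ C * L) :
    ENNReal.ofReal |2 * κ / ε * (I₁ + ε ^ (2 - 2 * β) * I₂)|
      ≤ ENNReal.ofReal (4 * ε ^ (γ + β * (n / 2)) * W)
        * (ENNReal.ofReal (1 / 2 * ε ^ (β - 1)) * Y * ENNReal.ofReal b
          + ENNReal.ofReal ε⁻¹ * X + ENNReal.ofReal (ε ^ (1 - 2 * β) * C)) := by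
  have hκ0 : 0 < κ := hκ ▸ Real.rpow_pos_of_pos hε _
  have hW' : 4 * ε ^ (γ + β * (n / 2)) * W = 4 * κ * L := by
    have : ε ^ (γ + β * (n / 2)) * ε ^ (γ + β * (n / 2)) = κ := by
      rw [hκ, ← Real.rpow_add hε]; congr 1; ring
    rw [hW, ← this]; ring
  have hβ1 : ε ^ (β - 1) = ε⁻¹ * ε ^ β := by
    rw [Real.rpow_sub hε, Real.rpow_one]; field_simp
  have hβ2 : ε ^ (1 - 2 * β) = ε⁻¹ * ε ^ (2 - 2 * β) := by
    rw [show (2 - 2 * β : ℝ) = 1 + (1 - 2 * β) by ring, Real.rpow_add hε, Real.rpow_one]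
    field_simp
  have hp : 0 < ε ^ (2 - 2 * β) := Real.rpow_pos_of_pos hε _
  have hpβ : 0 < ε ^ β := Real.rpow_pos_of_pos hε _
  have hfac : 0 ≤ 2 * κ / ε := by positivity
  have step1 : ENNReal.ofReal |2 * κ / ε * (I₁ + ε ^ (2 - 2 * β) * I₂)|
      ≤ ENNReal.ofReal (2 * κ / ε) * (ENNReal.ofReal |I₁|
        + ENNReal.ofReal (ε ^ (2 - 2 * β) * (C * L))) := by
    have hCL : 0 ≤ C * L := (abs_nonneg _).trans h2
    rw [← ENNReal.ofReal_add (abs_nonneg _) (by positivity), ← ENNReal.ofReal_mul hfac]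
    refine ENNReal.ofReal_le_ofReal ?_
    rw [abs_mul, abs_of_nonneg hfac]
    refine mul_le_mul_of_nonneg_left ((abs_add_le _ _).trans (add_le_add le_rfl ?_)) hfac
    rw [abs_mul, abs_of_pos hp]
    exact mul_le_mul_of_nonneg_left h2 hp.le
  have t1 : ENNReal.ofReal (2 * κ / ε) * (X * ENNReal.ofReal L)
      ≤ ENNReal.ofReal (4 * κ * L) * (ENNReal.ofReal ε⁻¹ * X) := by
    have : ENNReal.ofReal (2 * κ / ε) * ENNReal.ofReal L
        ≤ ENNReal.ofReal (4 * κ * L) * ENNReal.ofReal ε⁻¹ := by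
      rw [← ENNReal.ofReal_mul hfac, ← ENNReal.ofReal_mul (by positivity)]
      refine ENNReal.ofReal_le_ofReal ?_
      have : 0 ≤ κ * L * ε⁻¹ := by positivity
      rw [div_eq_mul_inv]
      nlinarith
    calc _ = ENNReal.ofReal (2 * κ / ε) * ENNReal.ofReal L * X := by ring
      _ ≤ ENNReal.ofReal (4 * κ * L) * ENNReal.ofReal ε⁻¹ * X := by gcongr
      _ = _ := by ring
  have t2 : ENNReal.ofReal (2 * κ / ε) * (ENNReal.ofReal (ε ^ β * b) * Y * ENNReal.ofReal L)
      = ENNReal.ofReal (4 * κ * L) * (ENNReal.ofReal (1 / 2 * ε ^ (β - 1)) * Y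
        * ENNReal.ofReal b) := by
    have : ENNReal.ofReal (2 * κ / ε) * ENNReal.ofReal (ε ^ β * b) * ENNReal.ofReal L
        = ENNReal.ofReal (4 * κ * L) * ENNReal.ofReal (1 / 2 * ε ^ (β - 1))
          * ENNReal.ofReal b := by
      rw [← ENNReal.ofReal_mul hfac, ← ENNReal.ofReal_mul (by positivity),
        ← ENNReal.ofReal_mul (by positivity), ← ENNReal.ofReal_mul (by rw [hβ1]; positivity), hβ1]
      congr 1
      field_simp
      ring
    calc _ = ENNReal.ofReal (2 * κ / ε) * ENNReal.ofReal (ε ^ β * b) * ENNReal.ofReal L * Y := by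
          ring
      _ = _ := by rw [this]; ring
  have t3 : ENNReal.ofReal (2 * κ / ε) * ENNReal.ofReal (ε ^ (2 - 2 * β) * (C * L))
      ≤ ENNReal.ofReal (4 * κ * L) * ENNReal.ofReal (ε ^ (1 - 2 * β) * C) := by
    have hCL : 0 ≤ C * L := (abs_nonneg _).trans h2
    rw [← ENNReal.ofReal_mul hfac, ← ENNReal.ofReal_mul (by positivity), hβ2]
    refine ENNReal.ofReal_le_ofReal ?_
    have : 0 ≤ κ * ε⁻¹ * ε ^ (2 - 2 * β) * (C * L) := by positivity
    rw [div_eq_mul_inv]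
    nlinarith
  rw [hW']
  calc _ ≤ ENNReal.ofReal (2 * κ / ε) * ((X + ENNReal.ofReal (ε ^ β * b) * Y) * ENNReal.ofReal L
        + ENNReal.ofReal (ε ^ (2 - 2 * β) * (C * L))) := step1.trans (by gcongr)
    _ = ENNReal.ofReal (2 * κ / ε) * (X * ENNReal.ofReal L)
        + ENNReal.ofReal (2 * κ / ε) * (ENNReal.ofReal (ε ^ β * b) * Y * ENNReal.ofReal L)
        + ENNReal.ofReal (2 * κ / ε) * ENNReal.ofReal (ε ^ (2 - 2 * β) * (C * L)) := by ring
    _ ≤ ENNReal.ofReal (4 * κ * L) * (ENNReal.ofReal ε⁻¹ * X)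
        + ENNReal.ofReal (4 * κ * L) * (ENNReal.ofReal (1 / 2 * ε ^ (β - 1)) * Y
        * ENNReal.ofReal b)
        + ENNReal.ofReal (4 * κ * L) * ENNReal.ofReal (ε ^ (1 - 2 * β) * C) := by
          rw [t2]; gcongr
    _ = _ := by ring

end SolitaryWave

end

theorem theorem2 (N : ℕ) (hN : 3 ≤ N) (ε α β γ ω : ℝ) (hε : 0 < ε)
    (f : Nonlinearity N) (hf : CommutesWithRescaling f (ε ^ (-β)))
    (hpar : (α = γ ∧ β = 1) ∨
      ∃ p : ℝ, 0 < p ∧ p < 2 / ((N : ℝ) - 2) ∧ HomogeneousOfDegree f p ∧ β = 1 + (α - γ) * p)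
    (U : Space N → ℝ) (hU : IsProfile f ω U) (hdecay : ProfileDecay U)
    (C : ℝ) (hC : IsRemainderConst f U (fun x => Complex.I * (U x : ℂ)) C)
    (V : Space N → ℝ)
    (a₀ ξ₀ : Space N) (θ₀ : ℝ) (a ξ : ℝ → Space N) (θ : ℝ → ℝ)
    (hV : RegularPotential V ∨ (SingularPotential V ∧ ∀ t, a t ≠ 0))
    (hσ : IsEffectiveTrajectory ε β U V a₀ ξ₀ θ₀ a ξ θ)
    (ωε : ℝ → ℝ) (hω : IsPhase ε β ω V a ξ ωε)
    (ψ : ℝ → Space N → ℂ)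
    (hψ : IsSolution ε α f V (solitary ε β γ U a₀ ξ₀ θ₀) ψ)
    (τ : ℝ)
    (hτ : ∀ t ∈ Set.Ioo 0 τ, l2norm (errorTilde ε β γ U (a t) (ξ t) (θ t) (ωε t) (ψ t)) ≤ 1) :
    ∀ t ∈ Set.Ioo 0 τ, ∃ d : ℝ,
      HasDerivAt (fun s => l2norm (errorW ε β γ U (a s) (ξ s) (θ s) (ωε s) (ψ s)) ^ 2) d t ∧
      ENNReal.ofReal |d| ≤
        ENNReal.ofReal (4 * ε ^ (γ + β * ((N : ℝ) / 2))
            * l2norm (errorW ε β γ U (a t) (ξ t) (θ t) (ωε t) (ψ t)))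
          * (ENNReal.ofReal (1 / 2 * ε ^ (β - 1))
                * eLpNorm (fun x : Space N => ‖x‖ * U x) 2 volume
                * ENNReal.ofReal ‖forceGap ε β U V (a t)‖
              + ENNReal.ofReal ε⁻¹
                * eLpNorm (fun x : Space N => |taylorRemainder ε β V (a t) x| * U x) 2 volume
              + ENNReal.ofReal (ε ^ (1 - 2 * β) * C)) := by
  intro t ht
  have hV' : RegularPotential V ∨ SingularPotential V := hV.imp_right And.left
  have hpar' : (α = γ ∧ β = 1) ∨ ∃ p : ℝ, HomogeneousOfDegree f p ∧ β = 1 + (α - γ) * p :=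
    hpar.imp_right fun ⟨p, _, _, h1, h2⟩ => ⟨p, h1, h2⟩
  have hVm := (aestronglyMeasurable_potential hN hV').1
  have hs : ε ^ (-β) ≠ 0 := (Real.rpow_pos_of_pos hε _).ne'
  set Z : ℝ → Space N → ℂ := fun s => gaugedSolitary ε β γ U (a s) (ξ s) (θ s) (ωε s) with hZ
  have hZf : ∀ s, Z s = frame ε β γ (a s) (ξ s) (θ s) (ωε s) (fun y => (U y : ℂ)) := fun s =>
    gaugedSolitary_eq_frame hε
  have hZE : ∀ s, MemEnergy V (Z s) := fun s => by
    rw [hZf]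
    exact memEnergy_boost hN hV' hU.memH1 hdecay.memLp_top hdecay.memLp_norm_mul _ _ _ hs
  set v := errorTilde ε β γ U (a t) (ξ t) (θ t) (ωε t) (ψ t) with hv
  set u : Space N → ℂ := fun y => (U y : ℂ) + v y with hu
  have hψu : frame ε β γ (a t) (ξ t) (θ t) (ωε t) u = ψ t := frame_add_errorTilde hε (ψ t)
  have hvH : MemH1 v := memH1_errorTilde hε hU.memH1 (hψ.mem t).1
  have huH : MemH1 u := memH1_of_frame hε (hψu.symm ▸ (hψ.mem t).1)
  have huE : MemEnergy V (frame ε β γ (a t) (ξ t) (θ t) (ωε t) u) := hψu.symm ▸ hψ.mem t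
  -- the overlap of the solution with the gauged solitary wave
  have hover := hasDerivAt_pair (fun s => (hψ.mem s).1.1) (fun s => (hZE s).1.1)
    (memLp_boost (memLp_frameVelocity ε β _ hU.memH1 hdecay (ξ t) _) _ _ _ hs)
    (hψ.tendsto_l2norm_sub t)
    (isLittleO_gaugedSolitary hε hU.memH1 hdecay (hσ.deriv_a t) (hσ.deriv_ξ t) (hσ.deriv_θ t)
      (hω.deriv t)) (hψ.hasDerivAt_pair_const hε (hZE t) t)
  have hval := overlap_derivative_eq hN hε hf hpar' hU hdecay hV' huH huE
  rw [hψu] at hval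
  rw [show ∀ w, boost _ _ _ _ w = frame ε β γ (a t) (ξ t) (θ t) (ωε t) w from fun w => rfl,
    hval] at hover
  set κ := ε ^ (2 * γ + β * N) with hκ
  set B₁ := pair (fun y => (effectivePotential ε β U V (a t) y : ℂ) * u y) (fun y => (U y : ℂ))
  set B₂ := gradPair u (fun y => (U y : ℂ))
      + pair (fun y => (f (fun z => ‖u z‖ ^ 2) y : ℂ) * u y) (fun y => (U y : ℂ))
      - ω * pair u (fun y => (U y : ℂ))
  have hre := (Complex.reCLM.hasFDerivAt (x := pair (ψ t) (Z t))).comp_hasDerivAt t hover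
  have hder := (((hψ.hasDerivAt_charge hε hVm t).sub (hre.const_mul 2)).add_const
    (κ * l2norm (fun y => (U y : ℂ)) ^ 2))
  have hreval : Complex.reCLM ((κ : ℂ) * (-(Complex.I / ε))
        * (B₁ + ((ε ^ (2 - 2 * β) : ℝ) : ℂ) * B₂))
      = κ / ε * (B₁.im + ε ^ (2 - 2 * β) * B₂.im) := by
    have h1 : (κ : ℂ) * (-(Complex.I / ε)) * (B₁ + ((ε ^ (2 - 2 * β) : ℝ) : ℂ) * B₂)
        = ((κ / ε : ℝ) : ℂ) * (-Complex.I * (B₁ + ((ε ^ (2 - 2 * β) : ℝ) : ℂ) * B₂)) := by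
      push_cast; ring
    rw [h1, Complex.reCLM_apply, Complex.re_ofReal_mul]
    simp
  rw [hreval] at hder
  refine ⟨_, hder.congr_of_eventuallyEq (.of_forall fun s => ?_), ?_⟩
  · have h1 : l2norm (errorW ε β γ U (a s) (ξ s) (θ s) (ωε s) (ψ s))
        = l2norm (fun x => ψ s x - Z s x) :=
      l2norm_congr_ae (.of_forall fun x => norm_errorW (ψ s) x)
    have h2 : l2norm (Z s) ^ 2 = κ * l2norm (fun y => (U y : ℂ)) ^ 2 := by
      rw [hZf, frame, l2norm_boost_sq _ _ _ hs hU.memH1.1, frame_factor hε]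
    simp only [h1, l2norm_sub_sq (hψ.mem s).1.1 (hZE s).1.1, h2]
    rfl
  · have hnl : Integrable (fun y => (f (fun z => ‖u z‖ ^ 2) y : ℂ) * u y * conj (U y : ℂ))
        volume := by
      have h1 := hψ.integrable t (Z t) (hZE t)
      rw [← hψu, hZf] at h1
      simp only [nonlinTerm_frame hε hf hpar'] at h1
      have h2 := integrable_of_frame hε (m := fun x => ((ε ^ (2 - 2 * β)
        * f (fun y => ‖u y‖ ^ 2) (-(ε ^ (-β) • a t) + ε ^ (-β) • x) : ℝ) : ℂ)) h1
      have hp : ((ε ^ (2 - 2 * β) : ℝ) : ℂ) ≠ 0 := by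
        exact_mod_cast (Real.rpow_pos_of_pos hε _).ne'
      have hb : ε ^ (-β) * ε ^ β = 1 := by rw [← Real.rpow_add hε]; simp
      refine (h2.const_mul ((ε ^ (2 - 2 * β) : ℝ) : ℂ)⁻¹).congr (.of_forall fun y => ?_)
      simp only [frame_arg, add_sub_cancel_left, smul_smul, hb, one_smul, Complex.ofReal_mul]
      rw [inv_mul_eq_iff_eq_mul₀ hp]
      ring
    have hpot := integrable_effectivePotential hN hε hU hdecay hV' huH.1 huE
    have h1 := ofReal_abs_im_effectivePotential_le hε hVm hU.memH1 hvH.1 hpot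
    have h2 := abs_im_nonlinear_le hU hC hvH (hτ t ht) huH hnl
    have h3 := ofReal_derivative_le (n := N) hε (l2norm_nonneg v) (norm_nonneg _) hκ
      (l2norm_errorW (a := a t) (ξ := ξ t) (θ := θ t) (ωε := ωε t) hε hU.memH1 (hψ.mem t).1) h1 h2
    refine le_trans (le_of_eq ?_) h3
    congr 1
    rw [← abs_neg]
    congr 1
    ring
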